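/- Identify $S^1=\mathbb R/2\pi\mathbb Z$, so that functions on $S^1$ are $2\pi$-periodic functions; write $H=L^2(S^1)$ and $V=W^{1,2}(S^1)$. Let $T\in(0,\infty)$ and let $u:[0,T]\times S^1\to\mathbb R^2$ be smooth, such that every $u(t)=u(t,\cdot)$ is an embedding and $0<d_0\le |u_x(t,x)|\le 1/d_0$ on $[0,T]\times S^1$ for some constant $d_0$. Write $ds(t)=|u_x(t)|\,dx$ and $\partial_s=\frac{1}{|u_x(t)|}\partial_x$. Let $\bar C>0$. Consider decompositions of $S^1$ into segments $S_j=[x_{j-1},x_j]$, $0=x_0<x_1<\dots<x_N=2\pi$ ($N\ge1$, $x_0$ and $x_N$ identified), with lengths $h_j$ and mesh size $h=\max_j h_j$, such that $h_j\ge\bar C h$ for all $j$, and let $S_h$ be the space of continuous functions on $S^1$ that are affine on each $S_j$. For $t\in[0,T]$ and $z\in V$ the geometric Ritz projection $\mathcal R_h z\in S_h$ at time $t$ is defined by $$\int_{S^1} z\,ds(t)=\int_{S^1}\mathcal R_h z\,ds(t),\qquad \int_{S^1}\partial_s z\,\partial_s\varphi_h\,ds(t)=\int_{S^1}\partial_s(\mathcal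 R_h z)\,\partial_s\varphi_h\,ds(t)\quad\forall\varphi_h\in S_h .$$ In $\mathcal R_h(z(t))$ the projection at time $t$ is meant. Lemma (properties of $\mathcal R_h$). There are constants $C,C_g\ge0$ that depend only on $u$, $T$, $d_0$ and $\bar C$, with $C_g=0$ if $u_x$ does not change in time (stationary curve), such that for every decomposition as above the Ritz projection exists and is unique for all $t\in[0,T]$ and $z\in V$, and, for $s\in\{1,2\}$, for every family with $z(t)\in W^{s,2}(S^1)$ for all $t\in[0,T]$, and for all $t,\tau\in[0,T]$: $$\|(\mathcal R_h(z(t))-\mathcal R_h(z(\tau)))_x\|_H\le C_g|t-\tau|h^{s-1}\|z(\tau)\|_{W^{s,2}(S^1)}+C\|(z(t)-z(\tau))_x\|_H,$$ $$\|\mathcal R_h(z(t))-\mathcal R_h(z(\tau))\|_H\le C_g|t-\tau|\,\|z(\tau)\|_V+C\|z(t)-z(\tau)\|_V,$$ $$\|(\mathcal R_h(z(t))-\mathcal R_h(z(\tau))-(z(t)-z(\tau)))_x\|_H\le Ch^{s-1}\|z(t)-z(\tau)\|_{W^{s,2}(S^1)}+C_g|t-\tau|h^{s-1}\|z(\tau)\|_{W^{s,2}(S^1)},$$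 $$\|\mathcal R_h(z(t))-\mathcal R_h(z(\tau))-(z(t)-z(\tau))\|_H\le C_g|t-\tau|h^{s}\|z(\tau)\|_{W^{s,2}(S^1)}+Ch^{s}\|z(t)-z(\tau)\|_{W^{s,2}(S^1)}.$$ -/

import Mathlib

open Set MeasureTheory
open scoped ContDiff Real

namespace CurveFEM

noncomputable section

/-! Functions on the circle `S¹ = ℝ / 2πℤ` are `2π`-periodic functions on `ℝ`,
and integrals over `S¹` are integrals over one period `[0, 2π]`. -/

/-- `f ∈ H = L²(S¹)`. -/
def MemL2 (f : ℝ → ℝ) : Prop :=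
  Function.Periodic f (2 * π) ∧ MemLp f 2 (volume.restrict (Ioc 0 (2 * π)))

/-- The norm of `L²(S¹)`. -/
def l2Norm (f : ℝ → ℝ) : ℝ :=
  Real.sqrt (∫ x in (0 : ℝ)..(2 * π), f x ^ 2)

/-- `g ∈ L²(S¹)` is a weak derivative of `f ∈ L²(S¹)`: the integration by parts formula holds
against every smooth function on the circle. -/
def IsWeakDeriv (f g : ℝ → ℝ) : Prop :=
  MemL2 f ∧ MemL2 g ∧
    ∀ φ : ℝ → ℝ, ContDiff ℝ ∞ φ → Function.Periodic φ (2 * π) →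
      ∫ x in (0 : ℝ)..(2 * π), f x * deriv φ x = -∫ x in (0 : ℝ)..(2 * π), g x * φ x

/-- A weak derivative `f_x` of `f` (unique up to null sets whenever there is one). -/
def weakDeriv (f : ℝ → ℝ) : ℝ → ℝ :=
  Classical.epsilon fun g => IsWeakDeriv f g

/-- `f ∈ W^{s,2}(S¹)`. -/
def MemSobolev : ℕ → (ℝ → ℝ) → Prop
  | 0, f => MemL2 f
  | s + 1, f => ∃ g, IsWeakDeriv f g ∧ MemSobolev s g

/-- The norm of `W^{s,2}(S¹)`, i.e. the square root of the sum of the squared `L²` norms of the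
weak derivatives of orders `0, …, s`. -/
def sobolevNorm (s : ℕ) (f : ℝ → ℝ) : ℝ :=
  Real.sqrt (∑ k ∈ Finset.range (s + 1), l2Norm (weakDeriv^[k] f) ^ 2)

/-- A smooth family `u(t, ·)`, `t ∈ [0, T]`, of regularly parametrised embedded closed curves in
the plane, with `d₀ ≤ |u_x| ≤ 1 / d₀`. (An injective immersion of the compact circle is an
embedding.) -/
structure IsEvolvingCurve (T d₀ : ℝ) (u : ℝ → ℝ → EuclideanSpace ℝ (Fin 2)) : Prop where
  smooth : ContDiffOn ℝ ∞ (fun p : ℝ × ℝ => u p.1 p.2) (Icc 0 T ×ˢ univ)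
  periodic : ∀ t ∈ Icc 0 T, Function.Periodic (u t) (2 * π)
  injOn : ∀ t ∈ Icc 0 T, InjOn (u t) (Ico 0 (2 * π))
  d₀_pos : 0 < d₀
  le_speed : ∀ t ∈ Icc 0 T, ∀ x, d₀ ≤ ‖deriv (u t) x‖
  speed_le : ∀ t ∈ Icc 0 T, ∀ x, ‖deriv (u t) x‖ ≤ 1 / d₀

/-- The length element `|u_x(t, x)|`. -/
def speed (u : ℝ → ℝ → EuclideanSpace ℝ (Fin 2)) (t x : ℝ) : ℝ :=
  ‖deriv (u t) x‖

/-- `∫_{S¹} f ds(t)` with `ds(t) = |u_x(t)| dx`. -/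
def arcIntegral (u : ℝ → ℝ → EuclideanSpace ℝ (Fin 2)) (t : ℝ) (f : ℝ → ℝ) : ℝ :=
  ∫ x in (0 : ℝ)..(2 * π), f x * speed u t x

/-- The arc-length derivative `∂_s f = f_x / |u_x(t)|`. -/
def arcDeriv (u : ℝ → ℝ → EuclideanSpace ℝ (Fin 2)) (t : ℝ) (f : ℝ → ℝ) : ℝ → ℝ :=
  fun x => weakDeriv f x / speed u t x

/-- A decomposition `0 = x_0 < x_1 < ⋯ < x_N = 2π` of the circle into `N ≥ 1` segments
(`x_0` and `x_N` are the same point of the circle). -/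
structure Mesh where
  N : ℕ
  pos : 0 < N
  node : Fin (N + 1) → ℝ
  strictMono : StrictMono node
  node_zero : node 0 = 0
  node_last : node (Fin.last N) = 2 * π

/-- The length of a segment. -/
def Mesh.len (M : Mesh) (j : Fin M.N) : ℝ := M.node j.succ - M.node j.castSucc

/-- The mesh size `h`, the maximal length of a segment. -/
def Mesh.size (M : Mesh) : ℝ := ⨆ j : Fin M.N, M.len j

/-- Every segment has length at least `Cbar * h`. -/
def Mesh.QuasiUniform (M : Mesh) (Cbar : ℝ) : Prop := ∀ j : Fin M.N, Cbar * M.size ≤ M.len j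

/-- `v ∈ S_h`: continuous functions on the circle that are affine on each segment. -/
def Mesh.MemSh (M : Mesh) (v : ℝ → ℝ) : Prop :=
  Continuous v ∧ Function.Periodic v (2 * π) ∧
    ∀ j : Fin M.N, ∃ a b : ℝ, ∀ x ∈ Icc (M.node j.castSucc) (M.node j.succ), v x = a + b * x

/-- `r` is a geometric Ritz projection of `z` at time `t`. -/
def IsRitz (u : ℝ → ℝ → EuclideanSpace ℝ (Fin 2)) (M : Mesh) (t : ℝ) (z r : ℝ → ℝ) : Prop :=
  M.MemSh r ∧
    arcIntegral u t z = arcIntegral u t r ∧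
    ∀ φ : ℝ → ℝ, M.MemSh φ →
      arcIntegral u t (fun x => arcDeriv u t z x * arcDeriv u t φ x) =
        arcIntegral u t (fun x => arcDeriv u t r x * arcDeriv u t φ x)

/-- The geometric Ritz projection `R_h z` at time `t`. -/
def ritz (u : ℝ → ℝ → EuclideanSpace ℝ (Fin 2)) (M : Mesh) (t : ℝ) (z : ℝ → ℝ) : ℝ → ℝ :=
  Classical.epsilon fun r => IsRitz u M t z r

end

end CurveFEM

open CurveFEM

namespace CurveFEM

/-! In one dimension the Ritz condition can be read segment by segment. Let `q` be the speed, `g =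
z_x`, and `ρ` the derivative of the projection. The derivatives of functions in `S_h` are exactly
the step functions of zero mean, so orthogonality amounts to the flux `(g - ρ) / q` having one
common mean `c` on all segments (`RitzData`). This yields an explicit projection
(`exists_ritzData`). Coercivity together with the mean condition yields uniqueness, and Céa's
argument the energy error (`RitzData.l2Norm_le_of_isStep`).

The extra power of `h` in `L²` needs no duality argument. The function `f = (g - ρ) / q - c`
integrates to zero on every segment, so its primitive vanishes at the nodes and is of order `h ‖g -
ρ‖`. In `g - ρ = q f + c q`, integration by parts bounds the primitive of `q f` by that of `f`, the
zero mean of `g - ρ` bounds `c`, and equality of the weighted means bounds the integration constant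
of `z - r` (`RitzData.l2Norm_error_le`).

For the time dependence, `R_t z(t) - R_τ z(τ) = R_t (z(t) - z(τ)) + (R_t - R_τ) z(τ)`. The first
term involves a single weight. The second compares two weights that differ, with their derivatives,
by at most `δ = L |t - τ|`: an energy argument gives `δ ‖g - σ‖` for the derivatives
(`RitzData.l2Norm_deriv_sub_le`), and the primitive argument applied to the difference of the fluxes
gives `δ h ‖g - σ‖` in `L²` (`exists_l2Norm_ritz_sub_le`). -/

/-- Square integrability over one period. -/
abbrev IsL2 (f : ℝ → ℝ) : Prop := MemLp f 2 (volume.restrict (Ioc 0 (2 * π)))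

/-! ### Cauchy–Schwarz and the `L²` norm on one period -/

section General

variable {α : Type*} [MeasurableSpace α] {μ : Measure α} {f g : α → ℝ}

theorem integrable_mul_of_memLp_two (hf : MemLp f 2 μ) (hg : MemLp g 2 μ) :
    Integrable (fun x => f x * g x) μ :=
  hf.integrable_mul hg

/-- The quadratic `t ↦ ∫ (t f + g)²` is nonnegative, so its discriminant is not positive. -/
theorem sq_integral_mul_le (hf : MemLp f 2 μ) (hg : MemLp g 2 μ) :
    (∫ x, f x * g x ∂μ) ^ 2 ≤ (∫ x, f x ^ 2 ∂μ) * ∫ x, g x ^ 2 ∂μ := by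
  have hfg := integrable_mul_of_memLp_two hf hg
  have h : ∀ t : ℝ, 0 ≤ (∫ x, f x ^ 2 ∂μ) * (t * t) + (2 * ∫ x, f x * g x ∂μ) * t
      + ∫ x, g x ^ 2 ∂μ := by
    intro t
    have h0 : 0 ≤ ∫ x, (t * f x + g x) ^ 2 ∂μ := integral_nonneg fun x => sq_nonneg _
    have h1 : ∫ x, (t * f x + g x) ^ 2 ∂μ
        = ∫ x, (t * t) * f x ^ 2 + ((2 * t) * (f x * g x) + g x ^ 2) ∂μ := by
      congr 1; ext x; ring
    have h2 : Integrable (fun x => (2 * t) * (f x * g x) + g x ^ 2) μ :=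
      (hfg.const_mul _).add hg.integrable_sq
    rw [h1, integral_add (hf.integrable_sq.const_mul _) h2,
      integral_add (hfg.const_mul _) hg.integrable_sq, integral_const_mul,
      integral_const_mul] at h0
    linarith
  have := discrim_le_zero h
  unfold discrim at this
  nlinarith

end General

theorem two_pi_pos : (0 : ℝ) < 2 * π := by positivity

theorem two_pi_le_seven : 2 * π ≤ 7 := by linarith [Real.pi_lt_d2]

theorem IsL2.intervalIntegrable {f : ℝ → ℝ} (hf : IsL2 f) :
    IntervalIntegrable f volume 0 (2 * π) := by
  rw [intervalIntegrable_iff_integrableOn_Ioc_of_le two_pi_pos.le]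
  exact hf.integrable (by norm_num)

theorem IsL2.mul_intervalIntegrable {f g : ℝ → ℝ} (hf : IsL2 f) (hg : IsL2 g) :
    IntervalIntegrable (fun x => f x * g x) volume 0 (2 * π) := by
  rw [intervalIntegrable_iff_integrableOn_Ioc_of_le two_pi_pos.le]
  exact integrable_mul_of_memLp_two hf hg

theorem IsL2.sq_intervalIntegrable {f : ℝ → ℝ} (hf : IsL2 f) :
    IntervalIntegrable (fun x => f x ^ 2) volume 0 (2 * π) := by
  simpa only [sq] using hf.mul_intervalIntegrable hf

theorem isL2_of_continuousOn {f : ℝ → ℝ} (hf : ContinuousOn f (Icc 0 (2 * π))) : IsL2 f := by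
  obtain ⟨C, hC⟩ := isCompact_Icc.exists_bound_of_continuousOn hf
  refine MemLp.of_bound ((hf.mono Ioc_subset_Icc_self).aestronglyMeasurable measurableSet_Ioc) C ?_
  filter_upwards [ae_restrict_mem measurableSet_Ioc] with x hx
  exact hC x (Ioc_subset_Icc_self hx)

theorem isL2_const (c : ℝ) : IsL2 fun _ => c := isL2_of_continuousOn continuousOn_const

theorem IsL2.mul_continuousOn {f p : ℝ → ℝ} (hf : IsL2 f)
    (hp : ContinuousOn p (Icc 0 (2 * π))) : IsL2 fun x => p x * f x := by
  obtain ⟨C, hC⟩ := isCompact_Icc.exists_bound_of_continuousOn hp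
  refine hf.of_le_mul (c := C)
    (((hp.mono Ioc_subset_Icc_self).aestronglyMeasurable measurableSet_Ioc).mul hf.1) ?_
  filter_upwards [ae_restrict_mem measurableSet_Ioc] with x hx
  rw [norm_mul]
  exact mul_le_mul_of_nonneg_right (hC x (Ioc_subset_Icc_self hx)) (norm_nonneg _)

theorem IsL2.const_mul' {f : ℝ → ℝ} (hf : IsL2 f) (c : ℝ) : IsL2 fun x => c * f x :=
  hf.mul_continuousOn continuousOn_const

theorem l2Norm_nonneg (f : ℝ → ℝ) : 0 ≤ l2Norm f := Real.sqrt_nonneg _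

theorem l2Norm_sq (f : ℝ → ℝ) : l2Norm f ^ 2 = ∫ x in (0 : ℝ)..(2 * π), f x ^ 2 :=
  Real.sq_sqrt (intervalIntegral.integral_nonneg two_pi_pos.le fun _ _ => sq_nonneg _)

theorem integral_congr_ae_period {f g : ℝ → ℝ}
    (h : f =ᵐ[volume.restrict (Ioc 0 (2 * π))] g) :
    ∫ x in (0 : ℝ)..(2 * π), f x = ∫ x in (0 : ℝ)..(2 * π), g x := by
  rw [intervalIntegral.integral_of_le two_pi_pos.le, intervalIntegral.integral_of_le two_pi_pos.le]
  exact integral_congr_ae h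

theorem l2Norm_congr_ae {f g : ℝ → ℝ} (h : f =ᵐ[volume.restrict (Ioc 0 (2 * π))] g) :
    l2Norm f = l2Norm g := by
  unfold l2Norm
  congr 1
  apply integral_congr_ae_period
  filter_upwards [h] with x hx
  rw [hx]

theorem abs_integral_mul_le {f g : ℝ → ℝ} (hf : IsL2 f) (hg : IsL2 g) :
    |∫ x in (0 : ℝ)..(2 * π), f x * g x| ≤ l2Norm f * l2Norm g := by
  apply abs_le_of_sq_le_sq _ (mul_nonneg (l2Norm_nonneg f) (l2Norm_nonneg g))
  rw [mul_pow, l2Norm_sq, l2Norm_sq]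
  simp only [intervalIntegral.integral_of_le two_pi_pos.le]
  exact sq_integral_mul_le hf hg

theorem l2Norm_add_le {f g : ℝ → ℝ} (hf : IsL2 f) (hg : IsL2 g) :
    l2Norm (fun x => f x + g x) ≤ l2Norm f + l2Norm g := by
  apply le_of_sq_le_sq _ (add_nonneg (l2Norm_nonneg f) (l2Norm_nonneg g))
  have h1 : l2Norm (fun x => f x + g x) ^ 2
      = l2Norm f ^ 2 + (2 * (∫ x in (0 : ℝ)..(2 * π), f x * g x) + l2Norm g ^ 2) := by
    rw [l2Norm_sq, l2Norm_sq, l2Norm_sq, ← intervalIntegral.integral_const_mul,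
      ← intervalIntegral.integral_add ((hf.mul_intervalIntegrable hg).const_mul _)
        hg.sq_intervalIntegrable, ← intervalIntegral.integral_add hf.sq_intervalIntegrable
        (((hf.mul_intervalIntegrable hg).const_mul _).add hg.sq_intervalIntegrable)]
    congr 1; ext x; ring
  rw [h1]
  have := (abs_le.1 (abs_integral_mul_le hf hg)).2
  nlinarith

theorem l2Norm_le_mul {f g : ℝ → ℝ} {c : ℝ} (hc : 0 ≤ c) (hg : IsL2 g)
    (h : ∀ᵐ x ∂(volume.restrict (Ioc 0 (2 * π))), |f x| ≤ c * |g x|) :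
    l2Norm f ≤ c * l2Norm g := by
  apply le_of_sq_le_sq _ (mul_nonneg hc (l2Norm_nonneg g))
  rw [mul_pow, l2Norm_sq, l2Norm_sq, ← intervalIntegral.integral_const_mul,
    intervalIntegral.integral_of_le two_pi_pos.le, intervalIntegral.integral_of_le two_pi_pos.le]
  apply integral_mono_of_nonneg (Filter.Eventually.of_forall fun x => sq_nonneg _)
    (hg.integrable_sq.const_mul _)
  filter_upwards [h] with x hx
  rw [← sq_abs (f x), ← sq_abs (g x), ← mul_pow]
  exact pow_le_pow_left₀ (abs_nonneg _) hx 2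

theorem l2Norm_neg (f : ℝ → ℝ) : l2Norm (fun x => -f x) = l2Norm f := by
  simp [l2Norm]

theorem l2Norm_sub_le {f g : ℝ → ℝ} (hf : IsL2 f) (hg : IsL2 g) :
    l2Norm (fun x => f x - g x) ≤ l2Norm f + l2Norm g := by
  have := l2Norm_add_le hf hg.neg
  simp only [Pi.neg_apply, ← sub_eq_add_neg] at this
  rwa [show l2Norm (-g) = l2Norm g from l2Norm_neg g] at this

/-- The recurring factor `3` is an upper bound for `√(2π)`. -/
theorem l2Norm_const_le (c : ℝ) : l2Norm (fun _ => c) ≤ 3 * |c| := by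
  apply le_of_sq_le_sq _ (by positivity)
  rw [l2Norm_sq, mul_pow, sq_abs]
  simp only [intervalIntegral.integral_const, sub_zero, smul_eq_mul]
  nlinarith [sq_nonneg c, two_pi_le_seven]

theorem l2Norm_le_of_forall_abs_le {f : ℝ → ℝ} {c : ℝ} (hc : 0 ≤ c)
    (h : ∀ x ∈ Ioc 0 (2 * π), |f x| ≤ c) : l2Norm f ≤ 3 * c := by
  have h1 : l2Norm f ≤ c * l2Norm (fun _ => 1) := by
    apply l2Norm_le_mul hc (isL2_const 1)
    filter_upwards [ae_restrict_mem measurableSet_Ioc] with x hx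
    simpa using h x hx
  have := l2Norm_const_le 1
  rw [abs_one] at this
  nlinarith

theorem integral_abs_le {f : ℝ → ℝ} (hf : IsL2 f) :
    ∫ x in (0 : ℝ)..(2 * π), |f x| ≤ 3 * l2Norm f := by
  have h1 := (abs_le.1 (abs_integral_mul_le hf.abs (isL2_const 1))).2
  have h2 := l2Norm_const_le 1
  have h3 : l2Norm |f| = l2Norm f := by simp [l2Norm]
  simp only [mul_one, Pi.abs_apply] at h1
  rw [h3] at h1
  rw [abs_one] at h2
  nlinarith [l2Norm_nonneg f]

theorem IsL2.intervalIntegrable_sub {f : ℝ → ℝ} (hf : IsL2 f) {a b : ℝ}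
    (ha : a ∈ Icc 0 (2 * π)) (hb : b ∈ Icc 0 (2 * π)) : IntervalIntegrable f volume a b :=
  hf.intervalIntegrable.mono_set (by
    rw [uIcc_of_le two_pi_pos.le]
    exact uIcc_subset_Icc ha hb)

theorem abs_integral_le_integral_abs_of_mem {f : ℝ → ℝ} {a b x : ℝ}
    (hf : IntervalIntegrable f volume a b) (hx : x ∈ Icc a b) :
    |∫ y in a..x, f y| ≤ ∫ y in a..b, |f y| := by
  refine (intervalIntegral.abs_integral_le_integral_abs hx.1).trans ?_
  apply intervalIntegral.integral_mono_interval le_rfl hx.1 hx.2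
    (Filter.Eventually.of_forall fun _ => abs_nonneg _) hf.abs

theorem IsL2.abs_integral_le {f : ℝ → ℝ} (hf : IsL2 f) {x : ℝ} (hx : x ∈ Icc 0 (2 * π)) :
    |∫ y in (0 : ℝ)..x, f y| ≤ 3 * l2Norm f :=
  (abs_integral_le_integral_abs_of_mem hf.intervalIntegrable hx).trans (CurveFEM.integral_abs_le hf)

theorem IsL2.continuousOn_primitive {f : ℝ → ℝ} (hf : IsL2 f) :
    ContinuousOn (fun x => ∫ y in (0 : ℝ)..x, f y) (Icc 0 (2 * π)) := by
  have := intervalIntegral.continuousOn_primitive_interval (a := 0) (b := 2 * π) (f := f)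
    (μ := volume) (by
      rw [uIcc_of_le two_pi_pos.le, integrableOn_Icc_iff_integrableOn_Ioc]
      exact hf.integrable (by norm_num))
  rwa [uIcc_of_le two_pi_pos.le] at this

/-! ### Integration by parts and periodic test functions -/

/-- Integration by parts against a primitive. -/
theorem integral_mul_eq_sub_of_primitive {P P' f : ℝ → ℝ} (hf : IsL2 f)
    (hP : ∀ x, HasDerivAt P (P' x) x) (hP' : Continuous P') {x : ℝ} (hx : x ∈ Icc 0 (2 * π)) :
    ∫ y in (0 : ℝ)..x, P y * f y = P x * (∫ y in (0 : ℝ)..x, f y)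
      - ∫ y in (0 : ℝ)..x, P' y * ∫ w in (0 : ℝ)..y, f w := by
  have hfi := hf.intervalIntegrable_sub (left_mem_Icc.2 two_pi_pos.le) hx
  -- The primitive of an `L²` function is only absolutely continuous, so its derivative is recovered
  -- almost everywhere.
  have hac := hfi.absolutelyContinuousOnInterval_intervalIntegral (c := 0) (by simp)
  have hd : deriv P = P' := funext fun y => (hP y).deriv
  have hPc : ContDiff ℝ 1 P := by
    rw [contDiff_one_iff_deriv]
    exact ⟨fun y => (hP y).differentiableAt, hd ▸ hP'⟩
  have h := (hPc.contDiffOn (s := uIcc 0 x)).absolutelyContinuousOnInterval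
    |>.integral_mul_deriv_eq_deriv_mul hac
  rw [hd] at h
  simp only [intervalIntegral.integral_same, mul_zero, sub_zero] at h
  rw [← h]
  apply intervalIntegral.integral_congr_ae
  filter_upwards [hfi.ae_hasDerivAt_integral] with y hy hy'
  rw [(hy (uIoc_subset_uIcc hy') 0 (by simp)).deriv]

/-- A smooth function compactly supported in the open period interval extends to a smooth
periodic function. -/
theorem exists_periodic_extension {φ : ℝ → ℝ} (hφ : ContDiff ℝ ∞ φ)
    (hs : tsupport φ ⊆ Ioo 0 (2 * π)) :
    ∃ ψ : ℝ → ℝ, ContDiff ℝ ∞ ψ ∧ Function.Periodic ψ (2 * π) ∧ ∀ x ∈ Ico 0 (2 * π), ψ x = φ x := by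
  have hz : ∀ x, x ∉ Ioo 0 (2 * π) → φ x = 0 := fun x hx =>
    image_eq_zero_of_notMem_tsupport fun h => hx (hs h)
  set ψ : ℝ → ℝ := fun x => φ (toIcoMod two_pi_pos 0 x) with hψ
  have hper : Function.Periodic ψ (2 * π) := fun x => by
    simp only [hψ]
    rw [toIcoMod_add_right]
  have hval : ∀ x ∈ Ico 0 (2 * π), ψ x = φ x := fun x hx => by
    simp only [hψ]
    rw [(toIcoMod_eq_self two_pi_pos).2 (by simpa using hx)]
  refine ⟨ψ, ?_, hper, hval⟩
  have hloc : ∀ y ∈ Ico 0 (2 * π), ContDiffAt ℝ ∞ ψ y := by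
    intro y hy
    -- On `(-2π, 2π)` the extension equals this sum, since one summand always vanishes there; this
    -- gives smoothness across the seam at `0`.
    have h1 : ContDiff ℝ ∞ fun x => φ x + φ (x + 2 * π) :=
      hφ.add (hφ.comp (contDiff_id.add contDiff_const))
    refine h1.contDiffAt.congr_of_eventuallyEq ?_
    filter_upwards [Ioo_mem_nhds (show -(2 * π) < y by linarith [hy.1, two_pi_pos]) hy.2] with x hx
    rcases le_or_gt 0 x with h0 | h0
    · rw [hval x ⟨h0, hx.2⟩, hz (x + 2 * π) (fun h => by linarith [h.2]), add_zero]
    · rw [← hper x, hval (x + 2 * π) ⟨by linarith [hx.1], by linarith⟩,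
        hz x (fun h => by linarith [h.1]), zero_add]
  rw [contDiff_iff_contDiffAt]
  intro x
  have hx := toIcoMod_mem_Ico two_pi_pos 0 x
  rw [zero_add] at hx
  have h2 : ψ = fun w => ψ (w - toIcoDiv two_pi_pos 0 x • (2 * π)) := by
    ext w
    rw [hper.sub_zsmul_eq]
  rw [h2]
  have h3 := hloc _ hx
  unfold toIcoMod at h3
  exact ContDiffAt.comp (g := ψ) x h3 (contDiffAt_id.sub contDiffAt_const)

/-- Bumps supported in the open period extend periodically, so the fundamental lemma of the calculus
of variations on `(0, 2π)` applies; the endpoint is a null set. -/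
theorem ae_eq_zero_of_integral_mul_periodic {f : ℝ → ℝ} (hf : IsL2 f)
    (h : ∀ ψ : ℝ → ℝ, ContDiff ℝ ∞ ψ → Function.Periodic ψ (2 * π) →
      ∫ x in (0 : ℝ)..(2 * π), f x * ψ x = 0) :
    f =ᵐ[volume.restrict (Ioc 0 (2 * π))] 0 := by
  have hint : IntegrableOn f (Ioc 0 (2 * π)) := hf.integrable (by norm_num)
  have key := isOpen_Ioo (a := (0 : ℝ)) (b := 2 * π)
    |>.ae_eq_zero_of_integral_contDiff_smul_eq_zero (μ := volume) (f := f)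
      (hint.mono_set Ioo_subset_Ioc_self).locallyIntegrableOn (by
      intro φ hφ _ hs
      obtain ⟨ψ, hψ, hper, hval⟩ := exists_periodic_extension hφ hs
      rw [← h ψ hψ hper, intervalIntegral.integral_of_le two_pi_pos.le,
        integral_Ioc_eq_integral_Ioo,
        ← setIntegral_eq_integral_of_forall_compl_eq_zero (s := Ioo 0 (2 * π))]
      · refine setIntegral_congr_fun measurableSet_Ioo fun x hx => ?_
        simp only [smul_eq_mul]
        rw [hval x (Ioo_subset_Ico_self hx), mul_comm]
      · intro x hx
        rw [image_eq_zero_of_notMem_tsupport fun h => hx (hs h), zero_smul])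
  rw [Filter.EventuallyEq, ← restrict_Ioo_eq_restrict_Ioc, ae_restrict_iff' measurableSet_Ioo]
  exact key

/-! ### Weak derivatives and Sobolev norms -/

theorem MemL2.isL2 {f : ℝ → ℝ} (hf : MemL2 f) : IsL2 f := hf.2

theorem MemL2.sub {f g : ℝ → ℝ} (hf : MemL2 f) (hg : MemL2 g) : MemL2 (f - g) :=
  ⟨hf.1.sub hg.1, hf.2.sub hg.2⟩

theorem isL2_of_continuous {f : ℝ → ℝ} (hf : Continuous f) : IsL2 f :=
  isL2_of_continuousOn hf.continuousOn

/-- Testing with the constant `1` suffices. Periodicity enters most later estimates through this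
fact. -/
theorem IsWeakDeriv.integral_eq_zero {f g : ℝ → ℝ} (h : IsWeakDeriv f g) :
    ∫ x in (0 : ℝ)..(2 * π), g x = 0 := by
  have := h.2.2 (fun _ => 1) contDiff_const (fun _ => rfl)
  simpa using this.symm

theorem IsWeakDeriv.sub {f g f' g' : ℝ → ℝ} (h : IsWeakDeriv f f') (h' : IsWeakDeriv g g') :
    IsWeakDeriv (f - g) (f' - g') := by
  refine ⟨h.1.sub h'.1, h.2.1.sub h'.2.1, fun φ hφ hp => ?_⟩
  have hd : IsL2 (deriv φ) := isL2_of_continuous (hφ.continuous_deriv (by simp))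
  have hc : IsL2 φ := isL2_of_continuous hφ.continuous
  simp only [Pi.sub_apply, sub_mul]
  rw [intervalIntegral.integral_sub (h.1.isL2.mul_intervalIntegrable hd)
    (h'.1.isL2.mul_intervalIntegrable hd), h.2.2 φ hφ hp, h'.2.2 φ hφ hp,
    intervalIntegral.integral_sub (h.2.1.isL2.mul_intervalIntegrable hc)
    (h'.2.1.isL2.mul_intervalIntegrable hc)]
  ring

theorem IsWeakDeriv.ae_unique {f g g' : ℝ → ℝ} (h : IsWeakDeriv f g) (h' : IsWeakDeriv f g') :
    g =ᵐ[volume.restrict (Ioc 0 (2 * π))] g' := by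
  have := ae_eq_zero_of_integral_mul_periodic (h.2.1.isL2.sub h'.2.1.isL2) (by
    intro ψ hψ hp
    have hc : IsL2 ψ := isL2_of_continuous hψ.continuous
    simp only [Pi.sub_apply, sub_mul]
    rw [intervalIntegral.integral_sub (h.2.1.isL2.mul_intervalIntegrable hc)
      (h'.2.1.isL2.mul_intervalIntegrable hc)]
    linarith [h.2.2 ψ hψ hp, h'.2.2 ψ hψ hp])
  filter_upwards [this] with x hx
  simpa [sub_eq_zero] using hx

theorem IsWeakDeriv.congr_left {f f' g : ℝ → ℝ} (h : IsWeakDeriv f g) (hf' : MemL2 f')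
    (he : f' =ᵐ[volume.restrict (Ioc 0 (2 * π))] f) : IsWeakDeriv f' g := by
  refine ⟨hf', h.2.1, fun φ hφ hp => ?_⟩
  rw [← h.2.2 φ hφ hp]
  apply integral_congr_ae_period
  filter_upwards [he] with x hx
  rw [hx]

theorem IsWeakDeriv.weakDeriv {f g : ℝ → ℝ} (h : IsWeakDeriv f g) :
    IsWeakDeriv f (weakDeriv f) :=
  Classical.epsilon_spec (p := fun g => IsWeakDeriv f g) ⟨g, h⟩

theorem IsWeakDeriv.weakDeriv_ae {f g : ℝ → ℝ} (h : IsWeakDeriv f g) :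
    CurveFEM.weakDeriv f =ᵐ[volume.restrict (Ioc 0 (2 * π))] g :=
  h.weakDeriv.ae_unique h

theorem IsWeakDeriv.l2Norm_weakDeriv {f g : ℝ → ℝ} (h : IsWeakDeriv f g) :
    l2Norm (CurveFEM.weakDeriv f) = l2Norm g :=
  l2Norm_congr_ae h.weakDeriv_ae

/-- A primitive of a function with vanishing mean has that function as its weak derivative. -/
theorem isWeakDeriv_of_primitive {f g : ℝ → ℝ} {c : ℝ} (hf : MemL2 f) (hg : MemL2 g)
    (h0 : ∫ x in (0 : ℝ)..(2 * π), g x = 0)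
    (h : ∀ x ∈ Ioc 0 (2 * π), f x = c + ∫ y in (0 : ℝ)..x, g y) : IsWeakDeriv f g := by
  refine ⟨hf, hg, fun φ hφ hp => ?_⟩
  have hd : Continuous (deriv φ) := hφ.continuous_deriv (by simp)
  have hder : ∀ x, HasDerivAt φ (deriv φ x) x := fun x =>
    (hφ.differentiable (by simp) x).hasDerivAt
  have h1 := integral_mul_eq_sub_of_primitive hg.isL2 hder hd (right_mem_Icc.2 two_pi_pos.le)
  rw [h0, mul_zero, zero_sub] at h1
  have h2 : ∫ x in (0 : ℝ)..(2 * π), g x * φ x = ∫ x in (0 : ℝ)..(2 * π), φ x * g x := by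
    simp only [mul_comm]
  rw [h2, h1, neg_neg]
  have h3 : ∫ x in (0 : ℝ)..(2 * π), deriv φ x = 0 := by
    rw [intervalIntegral.integral_deriv_eq_sub (fun x _ => hφ.differentiable (by simp) x)
      (hd.intervalIntegrable _ _)]
    have := hp 0
    rw [zero_add] at this
    rw [this, sub_self]
  have h4 : ∫ x in (0 : ℝ)..(2 * π), f x * deriv φ x
      = ∫ x in (0 : ℝ)..(2 * π), (c * deriv φ x + deriv φ x * ∫ y in (0 : ℝ)..x, g y) := by
    apply integral_congr_ae_period
    filter_upwards [ae_restrict_mem measurableSet_Ioc] with x hx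
    rw [h x hx]
    ring
  rw [h4, intervalIntegral.integral_add ((hd.intervalIntegrable _ _).const_mul c)
    ((isL2_of_continuous hd).mul_intervalIntegrable
      (isL2_of_continuousOn hg.isL2.continuousOn_primitive)),
    intervalIntegral.integral_const_mul, h3, mul_zero, zero_add]

/-- A function with a weak derivative is almost everywhere a primitive of it. -/
theorem IsWeakDeriv.exists_primitive {f g : ℝ → ℝ} (h : IsWeakDeriv f g) :
    ∃ c : ℝ, ∀ᵐ x ∂(volume.restrict (Ioc 0 (2 * π))), f x = c + ∫ y in (0 : ℝ)..x, g y := by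
  set G : ℝ → ℝ := fun x => ∫ y in (0 : ℝ)..x, g y with hG
  have hGL : IsL2 G := isL2_of_continuousOn h.2.1.isL2.continuousOn_primitive
  set k : ℝ → ℝ := fun x => f x - G x with hk
  have hkL : IsL2 k := h.1.isL2.sub hGL
  set m : ℝ := (∫ x in (0 : ℝ)..(2 * π), k x) / (2 * π) with hm
  have hm' : ∫ x in (0 : ℝ)..(2 * π), k x = m * (2 * π) := by
    rw [hm, div_mul_cancel₀ _ two_pi_pos.ne']
  have key := ae_eq_zero_of_integral_mul_periodic (f := fun x => k x - m)
    (hkL.sub (isL2_const m)) (by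
    intro ψ hψ hp
    -- Removing its mean makes `ψ` the derivative of a periodic function `φ`, which is an admissible
    -- test function.
    set a : ℝ := (∫ x in (0 : ℝ)..(2 * π), ψ x) / (2 * π) with ha
    have ha' : ∫ x in (0 : ℝ)..(2 * π), ψ x = a * (2 * π) := by
      rw [ha, div_mul_cancel₀ _ two_pi_pos.ne']
    have hψ0 : ContDiff ℝ ∞ fun x => ψ x - a := hψ.sub contDiff_const
    set φ : ℝ → ℝ := fun x => ∫ y in (0 : ℝ)..x, (ψ y - a) with hφdef
    have hder : ∀ x, HasDerivAt φ (ψ x - a) x := fun x =>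
      (hψ0.continuous.integral_hasStrictDerivAt 0 x).hasDerivAt
    have hd : deriv φ = fun x => ψ x - a := funext fun x => (hder x).deriv
    have hφ : ContDiff ℝ ∞ φ := by
      rw [contDiff_infty_iff_deriv]
      exact ⟨fun x => (hder x).differentiableAt, by rw [hd]; exact hψ0⟩
    have hmean : ∫ y in (0 : ℝ)..(2 * π), (ψ y - a) = 0 := by
      rw [intervalIntegral.integral_sub (hψ.continuous.intervalIntegrable _ _)
        (by simp), ha', intervalIntegral.integral_const, smul_eq_mul]
      ring
    have hφp : Function.Periodic φ (2 * π) := by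
      intro x
      have hp0 : Function.Periodic (fun y => ψ y - a) (2 * π) := fun y => by
        show ψ (y + 2 * π) - a = ψ y - a
        rw [hp y]
      have h2 := hp0.intervalIntegral_add_eq x 0
      rw [zero_add, hmean] at h2
      simp only [hφdef]
      rw [← intervalIntegral.integral_add_adjacent_intervals (b := x)
        (hψ0.continuous.intervalIntegrable _ _) (hψ0.continuous.intervalIntegrable _ _), h2,
        add_zero]
    have h1 := h.2.2 φ hφ hφp
    have h2 := integral_mul_eq_sub_of_primitive h.2.1.isL2 hder hψ0.continuous
      (right_mem_Icc.2 two_pi_pos.le)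
    have h3 : φ (2 * π) = 0 := hmean
    rw [h3, zero_mul, zero_sub] at h2
    have h4 : ∫ x in (0 : ℝ)..(2 * π), g x * φ x = ∫ x in (0 : ℝ)..(2 * π), φ x * g x := by
      simp only [mul_comm]
    rw [h4, h2, hd, neg_neg] at h1
    have hψL : IsL2 ψ := isL2_of_continuous hψ.continuous
    have hψ0L : IsL2 fun x => ψ x - a := isL2_of_continuous hψ0.continuous
    have h5 : ∫ x in (0 : ℝ)..(2 * π), (k x - m) * ψ x
        = ∫ x in (0 : ℝ)..(2 * π), ((f x * (ψ x - a) - (ψ x - a) * G x)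
          + (a * k x - m * ψ x)) := by
      congr 1; ext x; simp only [hk]; ring
    rw [h5, intervalIntegral.integral_add ((h.1.isL2.mul_intervalIntegrable hψ0L).sub
        (hψ0L.mul_intervalIntegrable hGL))
        ((hkL.intervalIntegrable.const_mul _).sub (hψL.intervalIntegrable.const_mul _)),
      intervalIntegral.integral_sub (h.1.isL2.mul_intervalIntegrable hψ0L)
        (hψ0L.mul_intervalIntegrable hGL),
      intervalIntegral.integral_sub (hkL.intervalIntegrable.const_mul _)
        (hψL.intervalIntegrable.const_mul _), intervalIntegral.integral_const_mul,
      intervalIntegral.integral_const_mul, h1, hm', ha']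
    ring)
  refine ⟨m, ?_⟩
  filter_upwards [key] with x hx
  simp only [hk, Pi.zero_apply] at hx
  linarith

theorem l2Norm_iterate_le_sobolevNorm {k s : ℕ} (hk : k ≤ s) (f : ℝ → ℝ) :
    l2Norm (weakDeriv^[k] f) ≤ sobolevNorm s f := by
  apply Real.le_sqrt_of_sq_le
  exact Finset.single_le_sum (f := fun k => l2Norm (weakDeriv^[k] f) ^ 2)
    (fun i _ => sq_nonneg _) (Finset.mem_range.2 (Nat.lt_succ_of_le hk))

theorem sobolevNorm_nonneg (s : ℕ) (f : ℝ → ℝ) : 0 ≤ sobolevNorm s f := Real.sqrt_nonneg _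

theorem memSobolev_one_iff {f : ℝ → ℝ} : MemSobolev 1 f ↔ ∃ g, IsWeakDeriv f g :=
  ⟨fun ⟨g, hg, _⟩ => ⟨g, hg⟩, fun ⟨g, hg⟩ => ⟨g, hg, hg.2.1⟩⟩

theorem MemSobolev.isWeakDeriv_weakDeriv {s : ℕ} {f : ℝ → ℝ} (h : MemSobolev (s + 1) f) :
    IsWeakDeriv f (weakDeriv f) :=
  h.elim fun _ hg => hg.1.weakDeriv

/-- The chosen derivative agrees only almost everywhere with the one that witnesses membership, so
the second derivative is transferred along this equality. -/
theorem MemSobolev.isWeakDeriv_weakDeriv_weakDeriv {f : ℝ → ℝ} (h : MemSobolev 2 f) :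
    IsWeakDeriv (weakDeriv f) (weakDeriv (weakDeriv f)) := by
  obtain ⟨g, hg, g', hg', _⟩ := h
  exact (hg'.congr_left hg.weakDeriv.2.1 hg.weakDeriv_ae).weakDeriv

theorem MemSobolev.sub {s : ℕ} {f g : ℝ → ℝ} (hf : MemSobolev s f) (hg : MemSobolev s g) :
    MemSobolev s (f - g) := by
  induction s generalizing f g with
  | zero => exact MemL2.sub hf hg
  | succ s ih =>
    obtain ⟨f', hf', hf''⟩ := hf
    obtain ⟨g', hg', hg''⟩ := hg
    exact ⟨f' - g', hf'.sub hg', ih hf'' hg''⟩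

/-! ### Meshes and step functions -/

namespace Mesh

variable (M : Mesh)

theorem node_mem (k : Fin (M.N + 1)) : M.node k ∈ Icc 0 (2 * π) := by
  rw [← M.node_zero, ← M.node_last]
  exact ⟨M.strictMono.monotone (Fin.zero_le k), M.strictMono.monotone (Fin.le_last k)⟩

theorem node_lt (j : Fin M.N) : M.node j.castSucc < M.node j.succ :=
  M.strictMono Fin.castSucc_lt_succ

theorem len_pos (j : Fin M.N) : 0 < M.len j := sub_pos.2 (M.node_lt j)

theorem len_le_size (j : Fin M.N) : M.len j ≤ M.size :=
  le_ciSup (f := M.len) (Set.finite_range _).bddAbove j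

theorem size_nonneg : 0 ≤ M.size :=
  (M.len_pos ⟨0, M.pos⟩).le.trans (M.len_le_size _)

theorem size_le : M.size ≤ 2 * π := by
  have : Nonempty (Fin M.N) := ⟨⟨0, M.pos⟩⟩
  refine ciSup_le fun j => ?_
  unfold len
  linarith [(M.node_mem j.succ).2, (M.node_mem j.castSucc).1]

theorem segment_subset (j : Fin M.N) :
    Icc (M.node j.castSucc) (M.node j.succ) ⊆ Icc 0 (2 * π) :=
  Icc_subset_Icc (M.node_mem _).1 (M.node_mem _).2

theorem intervalIntegrable_segment {f : ℝ → ℝ} (hf : IntervalIntegrable f volume 0 (2 * π))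
    (j : Fin M.N) : IntervalIntegrable f volume (M.node j.castSucc) (M.node j.succ) :=
  hf.mono_set (by
    rw [uIcc_of_le two_pi_pos.le, uIcc_of_le (M.node_lt j).le]
    exact M.segment_subset j)

theorem sum_integral {f : ℝ → ℝ} (hf : IntervalIntegrable f volume 0 (2 * π)) :
    ∑ j : Fin M.N, ∫ x in (M.node j.castSucc)..(M.node j.succ), f x
      = ∫ x in (0 : ℝ)..(2 * π), f x := by
  set a : ℕ → ℝ := fun k => if h : k < M.N + 1 then M.node ⟨k, h⟩ else 0 with ha
  have h1 : ∀ j : Fin M.N, a j = M.node j.castSucc := fun j => by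
    simp only [ha]
    rw [dif_pos (Nat.lt_succ_of_lt j.2)]
    rfl
  have h2 : ∀ j : Fin M.N, a (j + 1) = M.node j.succ := fun j => by
    simp only [ha]
    rw [dif_pos (Nat.succ_lt_succ j.2)]
    rfl
  have h3 := intervalIntegral.sum_integral_adjacent_intervals (μ := volume) (f := f) (a := a)
    (n := M.N) (fun k hk => by
      have := M.intervalIntegrable_segment hf ⟨k, hk⟩
      rw [← h1, ← h2] at this
      exact this)
  rw [Finset.sum_range] at h3
  simp only [h1, h2] at h3
  rw [h3]
  congr 1
  · rw [← M.node_zero]; simp [ha]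
  · rw [← M.node_last]; simp [ha]; rfl

/-- Induction along the nodes. -/
theorem node_induction {p : ℝ → Prop} (h0 : p 0)
    (h : ∀ j : Fin M.N, p (M.node j.castSucc) → p (M.node j.succ)) (k : Fin (M.N + 1)) :
    p (M.node k) := by
  induction k using Fin.induction with
  | zero => rwa [M.node_zero]
  | succ j ih => exact h j ih

theorem exists_mem_segment {x : ℝ} (hx : x ∈ Ioc 0 (2 * π)) :
    ∃ j : Fin M.N, x ∈ Ioc (M.node j.castSucc) (M.node j.succ) := by
  have h := M.node_induction
    (p := fun y => x ≤ y → ∃ j : Fin M.N, x ∈ Ioc (M.node j.castSucc) (M.node j.succ))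
    (fun h => absurd hx.1 (not_lt.2 h)) (fun j ih hle => by
      rcases le_or_gt x (M.node j.castSucc) with h | h
      · exact ih h
      · exact ⟨j, h, hle⟩) (Fin.last M.N)
  rw [M.node_last] at h
  exact h hx.2

theorem segment_unique {i j : Fin M.N} {x : ℝ}
    (hi : x ∈ Ioc (M.node i.castSucc) (M.node i.succ))
    (hj : x ∈ Ioc (M.node j.castSucc) (M.node j.succ)) : i = j := by
  have h1 : i.castSucc < j.succ := M.strictMono.lt_iff_lt.1 (hi.1.trans_le hj.2)
  have h2 : j.castSucc < i.succ := M.strictMono.lt_iff_lt.1 (hj.1.trans_le hi.2)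
  rw [Fin.lt_def] at h1 h2
  simp only [Fin.val_castSucc, Fin.val_succ] at h1 h2
  exact Fin.ext (by omega)

/-- `ρ` is, up to periodicity, the step function with value `p j` on the `j`-th segment. -/
structure IsStep (ρ : ℝ → ℝ) (p : Fin M.N → ℝ) : Prop where
  memL2 : MemL2 ρ
  eq : ∀ j, ∀ x ∈ Ioc (M.node j.castSucc) (M.node j.succ), ρ x = p j

theorem exists_isStep (p : Fin M.N → ℝ) : ∃ ρ, M.IsStep ρ p := by
  -- The half-open segments tile `(0, 2π]`, so at most one indicator is nonzero at a point;
  -- reduction by `toIocMod` uses the same half-open convention.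
  set σ : ℝ → ℝ := fun x => ∑ j : Fin M.N,
    (Ioc (M.node j.castSucc) (M.node j.succ)).indicator (fun _ => p j) x with hσ
  set ρ : ℝ → ℝ := fun x => σ (toIocMod two_pi_pos 0 x) with hρ
  have heq : ∀ x ∈ Ioc 0 (2 * π), ρ x = σ x := fun x hx => by
    simp only [hρ]
    rw [(toIocMod_eq_self two_pi_pos).2 (by simpa using hx)]
  have hσL : IsL2 σ := by
    apply memLp_finsetSum
    intro j _
    exact (memLp_const _).indicator measurableSet_Ioc
  refine ⟨ρ, ⟨fun x => ?_, ?_⟩, fun j x hx => ?_⟩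
  · simp only [hρ]
    rw [toIocMod_add_right]
  · refine hσL.ae_eq ?_
    filter_upwards [ae_restrict_mem measurableSet_Ioc] with x hx
    exact (heq x hx).symm
  · rw [heq x ⟨(M.node_mem _).1.trans_lt hx.1, hx.2.trans (M.node_mem _).2⟩]
    simp only [hσ]
    rw [Finset.sum_eq_single j]
    · rw [indicator_of_mem hx]
    · intro i _ hij
      exact indicator_of_notMem (fun hi => hij (M.segment_unique hi hx)) _
    · simp

variable {M}

theorem IsStep.isL2 {ρ : ℝ → ℝ} {p : Fin M.N → ℝ} (h : M.IsStep ρ p) : IsL2 ρ := h.memL2.2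

theorem IsStep.sub {ρ σ : ℝ → ℝ} {p q : Fin M.N → ℝ} (h : M.IsStep ρ p) (h' : M.IsStep σ q) :
    M.IsStep (ρ - σ) (p - q) :=
  ⟨h.memL2.sub h'.memL2, fun j x hx => by simp [h.eq j x hx, h'.eq j x hx]⟩

theorem IsStep.integral_segment_mul {ρ : ℝ → ℝ} {p : Fin M.N → ℝ} (h : M.IsStep ρ p)
    (f : ℝ → ℝ) (j : Fin M.N) {x : ℝ} (hx : x ∈ Icc (M.node j.castSucc) (M.node j.succ)) :
    ∫ y in (M.node j.castSucc)..x, ρ y * f y = p j * ∫ y in (M.node j.castSucc)..x, f y := by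
  rw [← intervalIntegral.integral_const_mul]
  apply intervalIntegral.integral_congr_ae
  filter_upwards with y hy
  rw [uIoc_of_le hx.1] at hy
  rw [h.eq j y ⟨hy.1, hy.2.trans hx.2⟩]

theorem IsStep.integral_segment {ρ : ℝ → ℝ} {p : Fin M.N → ℝ} (h : M.IsStep ρ p)
    (j : Fin M.N) {x : ℝ} (hx : x ∈ Icc (M.node j.castSucc) (M.node j.succ)) :
    ∫ y in (M.node j.castSucc)..x, ρ y = p j * (x - M.node j.castSucc) := by
  have := h.integral_segment_mul (fun _ => 1) j hx
  simpa using this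

theorem IsStep.integral_mul {ρ f : ℝ → ℝ} {p : Fin M.N → ℝ} (h : M.IsStep ρ p) (hf : IsL2 f) :
    ∫ x in (0 : ℝ)..(2 * π), ρ x * f x
      = ∑ j, p j * ∫ x in (M.node j.castSucc)..(M.node j.succ), f x := by
  rw [← M.sum_integral (h.isL2.mul_intervalIntegrable hf)]
  exact Finset.sum_congr rfl fun j _ =>
    h.integral_segment_mul f j (right_mem_Icc.2 (M.node_lt j).le)

theorem IsStep.integral {ρ : ℝ → ℝ} {p : Fin M.N → ℝ} (h : M.IsStep ρ p) :
    ∫ x in (0 : ℝ)..(2 * π), ρ x = ∑ j, p j * M.len j := by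
  rw [← M.sum_integral h.isL2.intervalIntegrable]
  exact Finset.sum_congr rfl fun j _ => h.integral_segment j (right_mem_Icc.2 (M.node_lt j).le)

end Mesh

/-! ### Finite element functions as primitives of step functions -/

theorem MemL2.intervalIntegrable {f : ℝ → ℝ} (hf : MemL2 f) (a b : ℝ) :
    IntervalIntegrable f volume a b :=
  hf.1.intervalIntegrable₀ two_pi_pos.ne' hf.isL2.intervalIntegrable a b

theorem MemL2.periodic_primitive {f : ℝ → ℝ} (hf : MemL2 f)
    (h0 : ∫ x in (0 : ℝ)..(2 * π), f x = 0) (c : ℝ) :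
    Function.Periodic (fun x => c + ∫ y in (0 : ℝ)..x, f y) (2 * π) := by
  intro x
  have h2 := hf.1.intervalIntegral_add_eq x 0
  rw [zero_add, h0] at h2
  simp only
  rw [← intervalIntegral.integral_add_adjacent_intervals (b := x)
    (hf.intervalIntegrable _ _) (hf.intervalIntegrable _ _), h2, add_zero]

theorem MemL2.continuous_primitive {f : ℝ → ℝ} (hf : MemL2 f) (c : ℝ) :
    Continuous (fun x => c + ∫ y in (0 : ℝ)..x, f y) :=
  continuous_const.add (intervalIntegral.continuous_primitive hf.intervalIntegrable 0)

theorem memL2_of_continuous {f : ℝ → ℝ} (hf : Continuous f) (hp : Function.Periodic f (2 * π)) :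
    MemL2 f := ⟨hp, isL2_of_continuous hf⟩

theorem MemL2.isWeakDeriv_primitive {f : ℝ → ℝ} (hf : MemL2 f)
    (h0 : ∫ x in (0 : ℝ)..(2 * π), f x = 0) (c : ℝ) :
    IsWeakDeriv (fun x => c + ∫ y in (0 : ℝ)..x, f y) f :=
  isWeakDeriv_of_primitive (c := c)
    (memL2_of_continuous (hf.continuous_primitive c) (hf.periodic_primitive h0 c)) hf h0
    fun _ _ => rfl

theorem Mesh.IsStep.memSh_primitive {M : Mesh} {ρ : ℝ → ℝ} {p : Fin M.N → ℝ} (h : M.IsStep ρ p)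
    (h0 : ∫ x in (0 : ℝ)..(2 * π), ρ x = 0) (c : ℝ) :
    M.MemSh (fun x => c + ∫ y in (0 : ℝ)..x, ρ y) := by
  refine ⟨h.memL2.continuous_primitive c, h.memL2.periodic_primitive h0 c, fun j =>
    ⟨c + (∫ y in (0 : ℝ)..(M.node j.castSucc), ρ y) - p j * M.node j.castSucc, p j,
      fun x hx => ?_⟩⟩
  simp only
  rw [← intervalIntegral.integral_add_adjacent_intervals (b := M.node j.castSucc)
    (h.memL2.intervalIntegrable _ _) (h.memL2.intervalIntegrable _ _), h.integral_segment j hx]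
  ring

/-- A finite element function is the primitive of a step function. -/
theorem Mesh.MemSh.exists_isStep {M : Mesh} {φ : ℝ → ℝ} (h : M.MemSh φ) :
    ∃ ρ p, M.IsStep ρ p ∧ IsWeakDeriv φ ρ ∧
      ∀ x ∈ Icc 0 (2 * π), φ x = φ 0 + ∫ y in (0 : ℝ)..x, ρ y := by
  obtain ⟨hc, hper, haff⟩ := h
  choose a b hab using haff
  obtain ⟨ρ, hρ⟩ := M.exists_isStep b
  -- If the formula holds at the left node, equality of slopes carries it over the whole segment,
  -- hence to the next node.
  have hstep : ∀ j : Fin M.N, φ (M.node j.castSucc) =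
      φ 0 + (∫ y in (0 : ℝ)..(M.node j.castSucc), ρ y) →
      ∀ x ∈ Icc (M.node j.castSucc) (M.node j.succ), φ x = φ 0 + ∫ y in (0 : ℝ)..x, ρ y := by
    intro j hj x hx
    rw [← intervalIntegral.integral_add_adjacent_intervals (b := M.node j.castSucc)
      (hρ.memL2.intervalIntegrable _ _) (hρ.memL2.intervalIntegrable _ _),
      hρ.integral_segment j hx, ← add_assoc, ← hj, hab j x hx,
      hab j _ (left_mem_Icc.2 (M.node_lt j).le)]
    ring
  have hnode := M.node_induction (p := fun x => φ x = φ 0 + ∫ y in (0 : ℝ)..x, ρ y) (by simp)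
    fun j hj => hstep j hj _ (right_mem_Icc.2 (M.node_lt j).le)
  have hall : ∀ x ∈ Icc 0 (2 * π), φ x = φ 0 + ∫ y in (0 : ℝ)..x, ρ y := by
    intro x hx
    rcases eq_or_lt_of_le hx.1 with h0 | h0
    · rw [← h0]; simp
    · obtain ⟨j, hj⟩ := M.exists_mem_segment ⟨h0, hx.2⟩
      exact hstep j (hnode _) x (Ioc_subset_Icc_self hj)
  have h0 : ∫ x in (0 : ℝ)..(2 * π), ρ x = 0 := by
    have h1 := hall _ (right_mem_Icc.2 two_pi_pos.le)
    have h2 := hper 0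
    rw [zero_add] at h2
    linarith
  exact ⟨ρ, b, hρ, isWeakDeriv_of_primitive (memL2_of_continuous hc hper) hρ.memL2 h0
    fun x hx => hall x (Ioc_subset_Icc_self hx), hall⟩

/-! ### Estimates on segments and approximation by segment means -/

theorem sq_integral_abs_le {f : ℝ → ℝ} (hf : IsL2 f) (M : Mesh) (j : Fin M.N) :
    (∫ x in (M.node j.castSucc)..(M.node j.succ), |f x|) ^ 2
      ≤ M.len j * ∫ x in (M.node j.castSucc)..(M.node j.succ), f x ^ 2 := by
  have hle := (M.node_lt j).le
  have hsub : Ioc (M.node j.castSucc) (M.node j.succ) ⊆ Ioc 0 (2 * π) :=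
    Ioc_subset_Ioc (M.node_mem _).1 (M.node_mem _).2
  have hf' : MemLp f 2 (volume.restrict (Ioc (M.node j.castSucc) (M.node j.succ))) :=
    hf.mono_measure (Measure.restrict_mono hsub le_rfl)
  have := sq_integral_mul_le (memLp_const (1 : ℝ)) hf'.abs
  simp only [intervalIntegral.integral_of_le hle]
  simpa [Mesh.len, hle] using this

/-- A function which on every segment is bounded by the integral of `|f|` over that segment. -/
theorem l2Norm_le_size_mul (M : Mesh) {f G : ℝ → ℝ} (hf : IsL2 f) (hG : IsL2 G)
    (h : ∀ j : Fin M.N, ∀ x ∈ Ioc (M.node j.castSucc) (M.node j.succ),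
      |G x| ≤ ∫ y in (M.node j.castSucc)..(M.node j.succ), |f y|) :
    l2Norm G ≤ M.size * l2Norm f := by
  apply le_of_sq_le_sq _ (mul_nonneg M.size_nonneg (l2Norm_nonneg f))
  rw [mul_pow, l2Norm_sq, l2Norm_sq, ← M.sum_integral hG.sq_intervalIntegrable,
    ← M.sum_integral hf.sq_intervalIntegrable, Finset.mul_sum]
  refine Finset.sum_le_sum fun j _ => ?_
  have hle := (M.node_lt j).le
  set I := ∫ y in (M.node j.castSucc)..(M.node j.succ), |f y| with hI
  have h1 : ∫ x in (M.node j.castSucc)..(M.node j.succ), G x ^ 2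
      ≤ ∫ x in (M.node j.castSucc)..(M.node j.succ), I ^ 2 := by
    rw [intervalIntegral.integral_of_le hle, intervalIntegral.integral_of_le hle]
    refine setIntegral_mono_on ?_ (by simp) measurableSet_Ioc fun x hx => ?_
    · exact (intervalIntegrable_iff_integrableOn_Ioc_of_le hle).1
        (M.intervalIntegrable_segment hG.sq_intervalIntegrable j)
    · rw [← sq_abs (G x)]
      exact pow_le_pow_left₀ (abs_nonneg _) (h j x hx) 2
  rw [intervalIntegral.integral_const, smul_eq_mul] at h1
  have h2 := sq_integral_abs_le hf M j
  have h3 : 0 ≤ ∫ x in (M.node j.castSucc)..(M.node j.succ), f x ^ 2 :=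
    intervalIntegral.integral_nonneg hle fun _ _ => sq_nonneg _
  have h4 := M.len_pos j
  have h5 := M.len_le_size j
  change _ ≤ M.len j * I ^ 2 at h1
  -- One factor of the length comes from integrating the constant `I ^ 2`, the other from
  -- Cauchy–Schwarz.
  calc _ ≤ M.len j * I ^ 2 := h1
    _ ≤ M.len j * (M.len j * ∫ x in (M.node j.castSucc)..(M.node j.succ), f x ^ 2) := by gcongr
    _ = M.len j ^ 2 * ∫ x in (M.node j.castSucc)..(M.node j.succ), f x ^ 2 := by ring
    _ ≤ _ := by gcongr

/-- A primitive vanishing at all nodes is small. -/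
theorem l2Norm_primitive_le (M : Mesh) {f : ℝ → ℝ} (hf : IsL2 f)
    (h : ∀ j : Fin M.N, ∫ x in (M.node j.castSucc)..(M.node j.succ), f x = 0) :
    l2Norm (fun x => ∫ y in (0 : ℝ)..x, f y) ≤ M.size * l2Norm f := by
  have hadd : ∀ j : Fin M.N, ∀ x ∈ Icc (M.node j.castSucc) (M.node j.succ),
      (∫ y in (0 : ℝ)..(M.node j.castSucc), f y) + ∫ y in (M.node j.castSucc)..x, f y
        = ∫ y in (0 : ℝ)..x, f y := fun j x hx =>
    intervalIntegral.integral_add_adjacent_intervals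
      (hf.intervalIntegrable_sub (left_mem_Icc.2 two_pi_pos.le) (M.node_mem _))
      (hf.intervalIntegrable_sub (M.node_mem _) (M.segment_subset j hx))
  have hnode := M.node_induction (p := fun x => ∫ y in (0 : ℝ)..x, f y = 0) (by simp)
    fun j hj => by
      rw [← hadd j _ (right_mem_Icc.2 (M.node_lt j).le), hj, h j, add_zero]
  refine l2Norm_le_size_mul M hf (isL2_of_continuousOn hf.continuousOn_primitive)
    fun j x hx => ?_
  have hx' := Ioc_subset_Icc_self hx
  rw [← hadd j x hx', hnode, zero_add]
  exact abs_integral_le_integral_abs_of_mem (M.intervalIntegrable_segment hf.intervalIntegrable j)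
    hx'

/-- Approximation of a Sobolev function by its means over the segments. -/
theorem exists_isStep_l2Norm_sub_le (M : Mesh) {g g' : ℝ → ℝ} (h : IsWeakDeriv g g') :
    ∃ ψ p, M.IsStep ψ p ∧ (∫ x in (0 : ℝ)..(2 * π), ψ x = ∫ x in (0 : ℝ)..(2 * π), g x) ∧
      l2Norm (fun x => g x - ψ x) ≤ M.size * l2Norm g' := by
  obtain ⟨c, hc⟩ := h.exists_primitive
  set G : ℝ → ℝ := fun x => c + ∫ y in (0 : ℝ)..x, g' y with hG
  have hGc : Continuous G := h.2.1.continuous_primitive c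
  -- Segment means preserve the total integral, so a derivative `g` of zero mean gives an admissible
  -- competitor.
  obtain ⟨ψ, hψ⟩ := M.exists_isStep fun j =>
    (∫ x in (M.node j.castSucc)..(M.node j.succ), G x) / M.len j
  refine ⟨ψ, _, hψ, ?_, ?_⟩
  · rw [hψ.integral, integral_congr_ae_period hc, ← M.sum_integral (hGc.intervalIntegrable _ _)]
    exact Finset.sum_congr rfl fun j _ => div_mul_cancel₀ _ (M.len_pos j).ne'
  · have he : l2Norm (fun x => g x - ψ x) = l2Norm (fun x => G x - ψ x) :=
      l2Norm_congr_ae (by filter_upwards [hc] with x hx; rw [hx])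
    rw [he]
    refine l2Norm_le_size_mul M h.2.1.isL2 ((isL2_of_continuous hGc).sub hψ.isL2)
      fun j x hx => ?_
    have hl := M.len_pos j
    have hle := (M.node_lt j).le
    have h1 : G x - ψ x = (∫ y in (M.node j.castSucc)..(M.node j.succ), (G x - G y)) / M.len j := by
      rw [hψ.eq j x hx, intervalIntegral.integral_sub (by simp) (hGc.intervalIntegrable _ _),
        intervalIntegral.integral_const, smul_eq_mul, sub_div, ← Mesh.len,
        mul_div_cancel_left₀ _ hl.ne']
    rw [h1, abs_div, abs_of_pos hl, div_le_iff₀ hl]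
    have h2 := intervalIntegral.norm_integral_le_of_norm_le_const (a := M.node j.castSucc)
      (b := M.node j.succ) (f := fun y => G x - G y)
      (C := ∫ y in (M.node j.castSucc)..(M.node j.succ), |g' y|) (by
      intro y hy
      rw [uIoc_of_le hle] at hy
      have h3 : G x - G y = ∫ w in y..x, g' w := by
        simp only [hG]
        rw [← intervalIntegral.integral_add_adjacent_intervals (b := y)
          (h.2.1.intervalIntegrable 0 y) (h.2.1.intervalIntegrable y x)]
        ring
      rw [h3]
      refine (intervalIntegral.norm_integral_le_integral_norm_uIoc).trans ?_
      rw [intervalIntegral.integral_of_le hle]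
      refine setIntegral_mono_set ?_ (Filter.Eventually.of_forall fun _ => abs_nonneg _) ?_
      · exact (intervalIntegrable_iff_integrableOn_Ioc_of_le hle).1
          (h.2.1.intervalIntegrable _ _).abs
      · refine Filter.Eventually.of_forall fun w hw => ?_
        rcases mem_uIoc.1 hw with hw | hw
        · exact ⟨hy.1.trans hw.1, hw.2.trans hx.2⟩
        · exact ⟨hx.1.trans hw.1, hw.2.trans hy.2⟩)
    rw [Real.norm_eq_abs, abs_of_pos (sub_pos.2 (M.node_lt j))] at h2
    exact h2

theorem Mesh.MemSh.sub {M : Mesh} {v w : ℝ → ℝ} (hv : M.MemSh v) (hw : M.MemSh w) :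
    M.MemSh (v - w) := by
  refine ⟨hv.1.sub hw.1, hv.2.1.sub hw.2.1, fun j => ?_⟩
  obtain ⟨a, b, hab⟩ := hv.2.2 j
  obtain ⟨a', b', hab'⟩ := hw.2.2 j
  refine ⟨a - a', b - b', fun x hx => ?_⟩
  rw [Pi.sub_apply, hab x hx, hab' x hx]
  ring

/-! ### Weights -/

/-- A continuously differentiable weight `q` with derivative `q'`, with `d ≤ q ≤ 1 / d` and
`|q'| ≤ K` on one period. -/
structure Weight (q q' : ℝ → ℝ) (d K : ℝ) : Prop where
  d_pos : 0 < d
  hasDerivAt : ∀ x, HasDerivAt q (q' x) x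
  continuous_deriv : Continuous q'
  le : ∀ x, d ≤ q x
  le_inv : ∀ x, q x ≤ 1 / d
  abs_deriv_le : ∀ x ∈ Icc 0 (2 * π), |q' x| ≤ K

namespace Weight

variable {q q' : ℝ → ℝ} {d K : ℝ}

theorem pos (h : Weight q q' d K) (x : ℝ) : 0 < q x := h.d_pos.trans_le (h.le x)

theorem continuous (h : Weight q q' d K) : Continuous q :=
  continuous_iff_continuousAt.2 fun x => (h.hasDerivAt x).continuousAt

theorem continuous_inv (h : Weight q q' d K) : Continuous fun x => (q x)⁻¹ :=
  h.continuous.inv₀ fun x => (h.pos x).ne'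

theorem isL2 (h : Weight q q' d K) : IsL2 q := isL2_of_continuous h.continuous

theorem isL2_div (h : Weight q q' d K) {f : ℝ → ℝ} (hf : IsL2 f) : IsL2 fun x => f x / q x := by
  have := hf.mul_continuousOn h.continuous_inv.continuousOn
  simpa only [div_eq_inv_mul] using this

theorem inv_le (h : Weight q q' d K) (x : ℝ) : (q x)⁻¹ ≤ 1 / d := by
  rw [one_div]; exact inv_anti₀ h.d_pos (h.le x)

theorem le_inv' (h : Weight q q' d K) (x : ℝ) : d ≤ (q x)⁻¹ := by
  have := h.le_inv x
  rw [one_div] at this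
  exact (le_inv_comm₀ (h.pos x) h.d_pos).1 this

theorem nonneg_bound (h : Weight q q' d K) : 0 ≤ K :=
  (abs_nonneg _).trans (h.abs_deriv_le 0 (left_mem_Icc.2 two_pi_pos.le))

theorem le_integral (h : Weight q q' d K) : 2 * π * d ≤ ∫ x in (0 : ℝ)..(2 * π), q x := by
  have := intervalIntegral.integral_mono_on (a := 0) (b := 2 * π) (μ := volume)
    (f := fun _ => d) two_pi_pos.le (by simp) (h.continuous.intervalIntegrable _ _)
    fun x _ => h.le x
  simpa using this

/-- Coercivity of the weighted energy. -/
theorem mul_sq_le (h : Weight q q' d K) {f : ℝ → ℝ} (hf : IsL2 f) :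
    d * l2Norm f ^ 2 ≤ ∫ x in (0 : ℝ)..(2 * π), f x * (f x / q x) := by
  rw [l2Norm_sq, ← intervalIntegral.integral_const_mul]
  refine intervalIntegral.integral_mono_on two_pi_pos.le (hf.sq_intervalIntegrable.const_mul _)
    (hf.mul_intervalIntegrable (h.isL2_div hf)) fun x _ => ?_
  rw [div_eq_mul_inv]
  nlinarith [h.le_inv' x, sq_nonneg (f x)]

theorem l2Norm_div_le (h : Weight q q' d K) {f : ℝ → ℝ} (hf : IsL2 f) :
    l2Norm (fun x => f x / q x) ≤ 1 / d * l2Norm f := by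
  refine l2Norm_le_mul (one_div_pos.2 h.d_pos).le hf (Filter.Eventually.of_forall fun x => ?_)
  rw [abs_div, abs_of_pos (h.pos x), div_eq_mul_inv, mul_comm]
  exact mul_le_mul_of_nonneg_right (h.inv_le x) (abs_nonneg _)

end Weight

/-! ### The flux form of the Ritz projection, existence and uniqueness -/

/-- `r` with step derivative `ρ` is the Ritz projection of `z`, with weak derivative `g`, for the
weight `q`: the flux `(g - ρ) / q` has the same mean `c` over all segments. -/
structure RitzData (M : Mesh) (q z r g ρ : ℝ → ℝ) (p : Fin M.N → ℝ) (c : ℝ) : Prop where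
  deriv_z : IsWeakDeriv z g
  memSh : M.MemSh r
  deriv_r : IsWeakDeriv r ρ
  step : M.IsStep ρ p
  flux : ∀ j, ∫ x in (M.node j.castSucc)..(M.node j.succ), (g x - ρ x) / q x = c * M.len j
  mean : ∫ x in (0 : ℝ)..(2 * π), z x * q x = ∫ x in (0 : ℝ)..(2 * π), r x * q x

section

variable {M : Mesh} {q q' z r g ρ : ℝ → ℝ} {d K c : ℝ} {p : Fin M.N → ℝ}

/-- Once `c` is known, the flux conditions decouple and determine each slope `p j`. The requirement
that `ρ` have zero mean is then one scalar linear equation for `c`, with positive coefficient `B`,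
and the weighted mean fixes the additive constant. -/
theorem exists_ritzData (M : Mesh) (hq : Weight q q' d K) (hz : IsWeakDeriv z g) :
    ∃ r ρ p c, RitzData M q z r g ρ p c := by
  set w : Fin M.N → ℝ := fun j => ∫ x in (M.node j.castSucc)..(M.node j.succ), (q x)⁻¹ with hw
  set A : Fin M.N → ℝ := fun j => ∫ x in (M.node j.castSucc)..(M.node j.succ), g x / q x with hA
  have hwpos : ∀ j, 0 < w j := fun j =>
    intervalIntegral.intervalIntegral_pos_of_pos (hq.continuous_inv.intervalIntegrable _ _)
      (fun x => inv_pos.2 (hq.pos x)) (M.node_lt j)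
  set B : ℝ := ∑ j, M.len j ^ 2 / w j with hB
  have hBpos : 0 < B := by
    have : Nonempty (Fin M.N) := ⟨⟨0, M.pos⟩⟩
    exact Finset.sum_pos (fun j _ => div_pos (pow_pos (M.len_pos j) 2) (hwpos j))
      Finset.univ_nonempty
  set c : ℝ := (∑ j, M.len j * A j / w j) / B with hc
  set p : Fin M.N → ℝ := fun j => (A j - c * M.len j) / w j with hp
  obtain ⟨ρ, hρ⟩ := M.exists_isStep p
  have h0 : ∫ x in (0 : ℝ)..(2 * π), ρ x = 0 := by
    rw [hρ.integral]
    have : ∀ j, p j * M.len j = M.len j * A j / w j - c * (M.len j ^ 2 / w j) := fun j => by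
      simp only [hp]; ring
    rw [Finset.sum_congr rfl fun j _ => this j, Finset.sum_sub_distrib, ← Finset.mul_sum, ← hB, hc,
      div_mul_cancel₀ _ hBpos.ne', sub_self]
  set R : ℝ → ℝ := fun x => ∫ y in (0 : ℝ)..x, ρ y with hR
  have hRc : Continuous R := by simpa using hρ.memL2.continuous_primitive 0
  have hqint : 0 < ∫ x in (0 : ℝ)..(2 * π), q x :=
    (mul_pos two_pi_pos hq.d_pos).trans_le hq.le_integral
  set a : ℝ := ((∫ x in (0 : ℝ)..(2 * π), z x * q x) - ∫ x in (0 : ℝ)..(2 * π), R x * q x)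
    / ∫ x in (0 : ℝ)..(2 * π), q x with ha
  refine ⟨fun x => a + R x, ρ, p, c, hz, hρ.memSh_primitive h0 a, hρ.memL2.isWeakDeriv_primitive h0 a,
    hρ, fun j => ?_, ?_⟩
  · simp only [sub_div]
    have h1 := hρ.integral_segment_mul (fun x => (q x)⁻¹) j (right_mem_Icc.2 (M.node_lt j).le)
    simp only [← div_eq_mul_inv] at h1
    rw [intervalIntegral.integral_sub
      (M.intervalIntegrable_segment (hq.isL2_div hz.2.1.isL2).intervalIntegrable j)
      (M.intervalIntegrable_segment (hq.isL2_div hρ.isL2).intervalIntegrable j), h1]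
    change A j - (A j - c * M.len j) / w j * w j = _
    rw [div_mul_cancel₀ _ (hwpos j).ne']
    ring
  · simp only [add_mul]
    rw [intervalIntegral.integral_add ((hq.continuous.intervalIntegrable _ _).const_mul a)
      ((isL2_of_continuous hRc).mul_intervalIntegrable hq.isL2), intervalIntegral.integral_const_mul, ha,
      div_mul_cancel₀ _ hqint.ne']
    ring

namespace RitzData

theorem isL2_sub (h : RitzData M q z r g ρ p c) : IsL2 fun x => g x - ρ x :=
  h.deriv_z.2.1.isL2.sub h.step.isL2

/-- All segment means of the flux equal `c`, so pairing with a step function gives `c` times its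
integral. -/
theorem orthogonal (h : RitzData M q z r g ρ p c) (hq : Weight q q' d K) {χ : ℝ → ℝ}
    {k : Fin M.N → ℝ} (hχ : M.IsStep χ k) (h0 : ∫ x in (0 : ℝ)..(2 * π), χ x = 0) :
    ∫ x in (0 : ℝ)..(2 * π), χ x * ((g x - ρ x) / q x) = 0 := by
  rw [hχ.integral_mul (hq.isL2_div h.isL2_sub)]
  rw [hχ.integral] at h0
  calc _ = ∑ j, c * (k j * M.len j) := Finset.sum_congr rfl fun j _ => by rw [h.flux j]; ring
    _ = 0 := by rw [← Finset.mul_sum, h0, mul_zero]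

/-- Linearity for a fixed weight lets the error estimates be applied to `z(t) - z(τ)` without
introducing its projection separately. -/
theorem sub (h : RitzData M q z r g ρ p c) (hq : Weight q q' d K) {z₂ r₂ g₂ ρ₂ : ℝ → ℝ}
    {p₂ : Fin M.N → ℝ} {c₂ : ℝ} (h₂ : RitzData M q z₂ r₂ g₂ ρ₂ p₂ c₂) :
    RitzData M q (z - z₂) (r - r₂) (g - g₂) (ρ - ρ₂) (p - p₂) (c - c₂) := by
  refine ⟨h.deriv_z.sub h₂.deriv_z, h.memSh.sub h₂.memSh, h.deriv_r.sub h₂.deriv_r, h.step.sub h₂.step, fun j => ?_, ?_⟩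
  · rw [sub_mul, ← h.flux j, ← h₂.flux j, ← intervalIntegral.integral_sub
      (M.intervalIntegrable_segment (hq.isL2_div h.isL2_sub).intervalIntegrable j)
      (M.intervalIntegrable_segment (hq.isL2_div h₂.isL2_sub).intervalIntegrable j)]
    congr 1; ext x
    simp only [Pi.sub_apply]
    ring
  · simp only [Pi.sub_apply, sub_mul]
    rw [intervalIntegral.integral_sub (h.deriv_z.1.isL2.mul_intervalIntegrable hq.isL2)
      (h₂.deriv_z.1.isL2.mul_intervalIntegrable hq.isL2),
      intervalIntegral.integral_sub (h.deriv_r.1.isL2.mul_intervalIntegrable hq.isL2)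
      (h₂.deriv_r.1.isL2.mul_intervalIntegrable hq.isL2), h.mean, h₂.mean]

end RitzData

end

section

variable {u : ℝ → ℝ → EuclideanSpace ℝ (Fin 2)} {t : ℝ} {M : Mesh} {z g q' : ℝ → ℝ} {d K : ℝ}

/-- Two arc-length derivatives contribute `1 / q²` and the length element `q`, leaving the weight `1
/ q`. -/
theorem arcIntegral_arcDeriv_mul {φ ψ : ℝ → ℝ} (hq : Weight (speed u t) q' d K)
    (hz : IsWeakDeriv z g) (hφ : IsWeakDeriv φ ψ) :
    arcIntegral u t (fun x => arcDeriv u t z x * arcDeriv u t φ x)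
      = ∫ x in (0 : ℝ)..(2 * π), ψ x * (g x / speed u t x) := by
  apply integral_congr_ae_period
  filter_upwards [hz.weakDeriv_ae, hφ.weakDeriv_ae] with x h1 h2
  simp only [arcDeriv]
  rw [h1, h2]
  have := (hq.pos x).ne'
  field_simp

theorem RitzData.isRitz {r ρ : ℝ → ℝ} {p : Fin M.N → ℝ} {c : ℝ}
    (hq : Weight (speed u t) q' d K) (h : RitzData M (speed u t) z r g ρ p c) :
    IsRitz u M t z r := by
  refine ⟨h.memSh, h.mean, fun φ hφ => ?_⟩
  obtain ⟨χ, k, hχ, hφχ, _⟩ := hφ.exists_isStep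
  rw [arcIntegral_arcDeriv_mul hq h.deriv_z hφχ, arcIntegral_arcDeriv_mul hq h.deriv_r hφχ,
    ← sub_eq_zero, ← intervalIntegral.integral_sub
      (hχ.isL2.mul_intervalIntegrable (hq.isL2_div h.deriv_z.2.1.isL2))
      (hχ.isL2.mul_intervalIntegrable (hq.isL2_div h.step.isL2))]
  refine Eq.trans ?_ (h.orthogonal hq hχ hφχ.integral_eq_zero)
  congr 1; ext x
  ring

/-- Testing both equations with the difference of the projections and using coercivity makes its
derivative vanish; equality of weighted means then removes the constant. -/
theorem IsRitz.unique {r₁ r₂ : ℝ → ℝ} (hq : Weight (speed u t) q' d K)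
    (h₁ : IsRitz u M t z r₁) (h₂ : IsRitz u M t z r₂) : r₁ = r₂ := by
  obtain ⟨hm₁, ha₁, ho₁⟩ := h₁
  obtain ⟨hm₂, ha₂, ho₂⟩ := h₂
  obtain ⟨ρ₁, p₁, hs₁, hd₁, hr₁⟩ := hm₁.exists_isStep
  obtain ⟨ρ₂, p₂, hs₂, hd₂, hr₂⟩ := hm₂.exists_isStep
  have hs := hs₁.sub hs₂
  have hd := hd₁.sub hd₂
  have hφ := hm₁.sub hm₂
  have h1 := (ho₁ _ hφ).symm.trans (ho₂ _ hφ)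
  rw [arcIntegral_arcDeriv_mul hq hd₁ hd, arcIntegral_arcDeriv_mul hq hd₂ hd, ← sub_eq_zero,
    ← intervalIntegral.integral_sub
      (hs.isL2.mul_intervalIntegrable (hq.isL2_div hs₁.isL2))
      (hs.isL2.mul_intervalIntegrable (hq.isL2_div hs₂.isL2))] at h1
  have h2 := hq.mul_sq_le hs.isL2
  have h3 : ∫ x in (0 : ℝ)..(2 * π), (ρ₁ - ρ₂) x * ((ρ₁ - ρ₂) x / speed u t x) = 0 := by
    refine Eq.trans ?_ h1
    congr 1; ext x
    simp only [Pi.sub_apply]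
    ring
  rw [h3] at h2
  have h4 : l2Norm (ρ₁ - ρ₂) = 0 := by
    have : l2Norm (ρ₁ - ρ₂) ^ 2 ≤ 0 := by
      by_contra hcon
      exact absurd h2 (not_le.2 (mul_pos hq.d_pos (not_le.1 hcon)))
    exact pow_eq_zero_iff two_ne_zero |>.1 (le_antisymm this (sq_nonneg _))
  have h5 : ∀ x ∈ Icc 0 (2 * π), r₁ x - r₂ x = r₁ 0 - r₂ 0 := by
    intro x hx
    have h6 := hs.isL2.abs_integral_le hx
    rw [h4, mul_zero] at h6
    have h7 := abs_nonpos_iff.1 h6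
    simp only [Pi.sub_apply] at h7
    rw [intervalIntegral.integral_sub (hs₁.memL2.intervalIntegrable _ _)
      (hs₂.memL2.intervalIntegrable _ _)] at h7
    rw [hr₁ x hx, hr₂ x hx]
    linarith
  have h8 : (r₁ 0 - r₂ 0) * ∫ x in (0 : ℝ)..(2 * π), speed u t x = 0 := by
    have h9 := sub_eq_zero.2 (ha₁.symm.trans ha₂)
    unfold arcIntegral at h9
    rw [← intervalIntegral.integral_sub (hd₁.1.isL2.mul_intervalIntegrable hq.isL2)
      (hd₂.1.isL2.mul_intervalIntegrable hq.isL2)] at h9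
    rw [← intervalIntegral.integral_const_mul]
    refine Eq.trans ?_ h9
    apply integral_congr_ae_period
    filter_upwards [ae_restrict_mem measurableSet_Ioc] with x hx
    rw [← sub_mul, h5 x (Ioc_subset_Icc_self hx)]
  have h10 : r₁ 0 - r₂ 0 = 0 := by
    rcases mul_eq_zero.1 h8 with h | h
    · exact h
    · exact absurd h ((mul_pos two_pi_pos hq.d_pos).trans_le hq.le_integral).ne'
  have hper : Function.Periodic (r₁ - r₂) (2 * π) := hm₁.2.1.sub hm₂.2.1
  ext x
  obtain ⟨y, hy, hxy⟩ := hper.exists_mem_Ico₀ two_pi_pos x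
  simp only [Pi.sub_apply] at hxy
  rw [h5 y (Ico_subset_Icc_self hy), h10] at hxy
  linarith

theorem existsUnique_isRitz (hq : Weight (speed u t) q' d K) (hz : IsWeakDeriv z g) :
    ∃! r, IsRitz u M t z r := by
  obtain ⟨r, ρ, p, c, h⟩ := exists_ritzData M hq hz
  exact ⟨r, h.isRitz hq, fun r' hr' => hr'.unique hq (h.isRitz hq)⟩

theorem ritzData_ritz (M : Mesh) (hq : Weight (speed u t) q' d K) (hz : IsWeakDeriv z g) :
    ∃ ρ p c, RitzData M (speed u t) z (ritz u M t z) g ρ p c := by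
  obtain ⟨r, ρ, p, c, h⟩ := exists_ritzData M hq hz
  have h1 : IsRitz u M t z (ritz u M t z) :=
    Classical.epsilon_spec (p := fun r => IsRitz u M t z r) ⟨r, h.isRitz hq⟩
  have h2 : ritz u M t z = r := h1.unique hq (h.isRitz hq)
  exact ⟨ρ, p, c, by rw [h2]; exact h⟩

end

/-! ### Bounds for primitives -/

theorem one_le_two_pi : 1 ≤ 2 * π := by linarith [Real.pi_gt_three]

theorem IsL2.isL2_primitive {f : ℝ → ℝ} (hf : IsL2 f) : IsL2 fun x => ∫ y in (0 : ℝ)..x, f y :=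
  isL2_of_continuousOn hf.continuousOn_primitive

theorem IsL2.add' {f g : ℝ → ℝ} (hf : IsL2 f) (hg : IsL2 g) : IsL2 fun x => f x + g x :=
  hf.add hg

/-- Here `c` is the mean of `f`, so `2π |c| ≤ 3 ‖f‖`; since `3 ≤ 2π`, subtracting `c` costs at most
three more copies of `‖f‖`. -/
theorem l2Norm_sub_const_le_of_integral_eq_zero {f : ℝ → ℝ} {c : ℝ} (hf : IsL2 f)
    (h : ∫ x in (0 : ℝ)..(2 * π), (f x - c) = 0) :
    l2Norm (fun x => f x - c) ≤ 4 * l2Norm f := by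
  have h1 := l2Norm_sub_le hf (isL2_const c)
  have h2 := l2Norm_const_le c
  rw [intervalIntegral.integral_sub hf.intervalIntegrable (by simp),
    intervalIntegral.integral_const, smul_eq_mul, sub_zero, sub_eq_zero] at h
  have h3 := hf.abs_integral_le (right_mem_Icc.2 two_pi_pos.le)
  rw [h, abs_mul, abs_of_pos two_pi_pos] at h3
  have h4 : 3 * |c| ≤ 2 * π * |c| :=
    mul_le_mul_of_nonneg_right (by linarith [Real.pi_gt_three]) (abs_nonneg c)
  linarith

section ByParts

variable {P P' f : ℝ → ℝ} {A B : ℝ}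

/-- Integration by parts moves the derivative onto `P`, so only the primitive of `f` enters and not
`f` itself. This preserves the gain of one order in `h`. -/
theorem abs_integral_mul_le_of_primitive (hf : IsL2 f) (hP : ∀ x, HasDerivAt P (P' x) x)
    (hP' : Continuous P') (hA : ∀ x ∈ Icc 0 (2 * π), |P x| ≤ A)
    (hB : ∀ x ∈ Icc 0 (2 * π), |P' x| ≤ B) {x : ℝ} (hx : x ∈ Icc 0 (2 * π)) :
    |∫ y in (0 : ℝ)..x, P y * f y| ≤ A * |∫ y in (0 : ℝ)..x, f y|
      + 3 * B * l2Norm fun x => ∫ y in (0 : ℝ)..x, f y := by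
  set F : ℝ → ℝ := fun x => ∫ y in (0 : ℝ)..x, f y with hF
  have hFL : IsL2 F := hf.isL2_primitive
  have hB0 : 0 ≤ B := (abs_nonneg _).trans (hB x hx)
  rw [integral_mul_eq_sub_of_primitive hf hP hP' hx]
  have h1 : IsL2 fun y => P' y * F y := hFL.mul_continuousOn hP'.continuousOn
  have h2 : |∫ y in (0 : ℝ)..x, P' y * F y| ≤ 3 * B * l2Norm F := by
    refine (h1.abs_integral_le hx).trans ?_
    have : l2Norm (fun y => P' y * F y) ≤ B * l2Norm F := by
      refine l2Norm_le_mul hB0 hFL ?_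
      filter_upwards [ae_restrict_mem measurableSet_Ioc] with y hy
      rw [abs_mul]
      exact mul_le_mul_of_nonneg_right (hB y (Ioc_subset_Icc_self hy)) (abs_nonneg _)
    linarith
  have h3 : |P x * F x| ≤ A * |F x| := by
    rw [abs_mul]
    exact mul_le_mul_of_nonneg_right (hA x hx) (abs_nonneg _)
  exact (abs_sub _ _).trans (add_le_add h3 h2)

theorem l2Norm_integral_mul_le (hf : IsL2 f) (hP : ∀ x, HasDerivAt P (P' x) x)
    (hP' : Continuous P') (hA : ∀ x ∈ Icc 0 (2 * π), |P x| ≤ A)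
    (hB : ∀ x ∈ Icc 0 (2 * π), |P' x| ≤ B) :
    l2Norm (fun x => ∫ y in (0 : ℝ)..x, P y * f y)
      ≤ (A + 9 * B) * l2Norm fun x => ∫ y in (0 : ℝ)..x, f y := by
  set F : ℝ → ℝ := fun x => ∫ y in (0 : ℝ)..x, f y with hF
  have hFL : IsL2 F := hf.isL2_primitive
  have h0 := left_mem_Icc.2 two_pi_pos.le
  have hA0 : 0 ≤ A := (abs_nonneg _).trans (hA 0 h0)
  have hB0 : 0 ≤ B := (abs_nonneg _).trans (hB 0 h0)
  set b : ℝ := 3 * B * l2Norm F with hb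
  have hb0 : 0 ≤ b := by have := l2Norm_nonneg F; positivity
  have hAF : IsL2 fun x => A * |F x| := hFL.abs.const_mul' A
  have h1 : l2Norm (fun x => ∫ y in (0 : ℝ)..x, P y * f y)
      ≤ 1 * l2Norm fun x => A * |F x| + b := by
    refine l2Norm_le_mul zero_le_one (hAF.add (isL2_const b)) ?_
    filter_upwards [ae_restrict_mem measurableSet_Ioc] with x hx
    have hx' := Ioc_subset_Icc_self hx
    rw [one_mul, abs_of_nonneg (add_nonneg (mul_nonneg hA0 (abs_nonneg (F x))) hb0)]
    exact abs_integral_mul_le_of_primitive hf hP hP' hA hB hx'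
  have h2 := l2Norm_add_le hAF (isL2_const b)
  have h3 := l2Norm_const_le b
  rw [abs_of_nonneg hb0] at h3
  have h4 : l2Norm (fun x => A * |F x|) ≤ A * l2Norm F := by
    refine l2Norm_le_mul hA0 hFL (Filter.Eventually.of_forall fun x => ?_)
    rw [abs_mul, abs_abs, abs_of_nonneg hA0]
  linarith

end ByParts

section Primitive

variable {q q' : ℝ → ℝ} {d K : ℝ}

theorem Weight.abs_le (hq : Weight q q' d K) (x : ℝ) : |q x| ≤ 1 / d := by
  rw [abs_of_pos (hq.pos x)]
  exact hq.le_inv x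

theorem Weight.abs_integral_le (hq : Weight q q' d K) {x : ℝ} (hx : x ∈ Icc 0 (2 * π)) :
    |∫ y in (0 : ℝ)..x, q y| ≤ 7 / d := by
  have h := intervalIntegral.norm_integral_le_of_norm_le_const (a := 0) (b := x) (f := q)
    (C := 1 / d) fun y _ => hq.abs_le y
  rw [Real.norm_eq_abs, sub_zero, abs_of_nonneg hx.1] at h
  have h1 : 1 / d * x ≤ 1 / d * 7 :=
    mul_le_mul_of_nonneg_left (hx.2.trans two_pi_le_seven) (one_div_pos.2 hq.d_pos).le
  calc _ ≤ _ := h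
    _ ≤ _ := h1
    _ = 7 / d := by ring

/-- If `s + q f + κ q` and `f` have vanishing mean, then `κ` is controlled by the primitives of
`s` and `f`. -/
theorem Weight.abs_coeff_le (hq : Weight q q' d K) {s f : ℝ → ℝ} {κ σ : ℝ} (hs : IsL2 s)
    (hf : IsL2 f) (hf0 : ∫ x in (0 : ℝ)..(2 * π), f x = 0)
    (h0 : ∫ x in (0 : ℝ)..(2 * π), (s x + q x * f x + κ * q x) = 0)
    (hσ : |∫ x in (0 : ℝ)..(2 * π), s x| ≤ σ) :
    |κ| ≤ (σ + 3 * K * l2Norm fun x => ∫ y in (0 : ℝ)..x, f y) / d := by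
  have hqf : IsL2 fun x => q x * f x := hf.mul_continuousOn hq.continuous.continuousOn
  rw [intervalIntegral.integral_add (hs.add' hqf).intervalIntegrable
      (hq.isL2.const_mul' κ).intervalIntegrable,
    intervalIntegral.integral_add hs.intervalIntegrable hqf.intervalIntegrable,
    intervalIntegral.integral_const_mul] at h0
  have h1 := abs_integral_mul_le_of_primitive hf hq.hasDerivAt hq.continuous_deriv
    (fun x _ => hq.abs_le x) hq.abs_deriv_le (right_mem_Icc.2 two_pi_pos.le)
  rw [hf0, abs_zero, mul_zero, zero_add] at h1
  have hd := hq.d_pos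
  have h2 : d ≤ ∫ x in (0 : ℝ)..(2 * π), q x := by
    have := hq.le_integral
    nlinarith [one_le_two_pi]
  have h3 : |κ * ∫ x in (0 : ℝ)..(2 * π), q x|
      ≤ σ + 3 * K * l2Norm fun x => ∫ y in (0 : ℝ)..x, f y := by
    have h4 : κ * (∫ x in (0 : ℝ)..(2 * π), q x)
      = -((∫ x in (0 : ℝ)..(2 * π), s x) + ∫ x in (0 : ℝ)..(2 * π), q x * f x) := by linarith
    rw [h4, abs_neg]
    exact (abs_add_le _ _).trans (add_le_add hσ h1)
  rw [le_div_iff₀ hd]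
  rw [abs_mul, abs_of_pos (hd.trans_le h2)] at h3
  exact (mul_le_mul_of_nonneg_left h2 (abs_nonneg κ)).trans h3

/-- The three summands are treated separately: `s` by assumption, `q f` by parts, and `κ q` through
`Weight.abs_coeff_le`. The factors `21 = 3 * 7` and `63 = 3 * 21` come from the bounds `√(2π) ≤ 3`
and `2π ≤ 7`. -/
theorem Weight.l2Norm_primitive_le (hq : Weight q q' d K) {s f : ℝ → ℝ} {κ σ : ℝ} (hs : IsL2 s)
    (hf : IsL2 f) (hf0 : ∫ x in (0 : ℝ)..(2 * π), f x = 0)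
    (h0 : ∫ x in (0 : ℝ)..(2 * π), (s x + q x * f x + κ * q x) = 0)
    (hσ : |∫ x in (0 : ℝ)..(2 * π), s x| ≤ σ)
    (hσ' : l2Norm (fun x => ∫ y in (0 : ℝ)..x, s y) ≤ σ) :
    l2Norm (fun x => ∫ y in (0 : ℝ)..x, (s y + q y * f y + κ * q y))
      ≤ (1 + 21 / d ^ 2) * σ
        + (1 / d + 9 * K + 63 * K / d ^ 2) * l2Norm fun x => ∫ y in (0 : ℝ)..x, f y := by
  have hqf : IsL2 fun x => q x * f x := hf.mul_continuousOn hq.continuous.continuousOn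
  have hκq : IsL2 fun x => κ * q x := hq.isL2.const_mul' κ
  have hκ := hq.abs_coeff_le hs hf hf0 h0 hσ
  set F : ℝ → ℝ := fun x => ∫ y in (0 : ℝ)..x, f y with hF
  have hd := hq.d_pos
  have h1 : l2Norm (fun x => ∫ y in (0 : ℝ)..x, (s y + q y * f y + κ * q y))
      = l2Norm (fun x => ((∫ y in (0 : ℝ)..x, s y) + ∫ y in (0 : ℝ)..x, q y * f y)
        + ∫ y in (0 : ℝ)..x, κ * q y) := by
    apply l2Norm_congr_ae
    filter_upwards [ae_restrict_mem measurableSet_Ioc] with x hx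
    have h0x := left_mem_Icc.2 two_pi_pos.le
    have hx' := Ioc_subset_Icc_self hx
    rw [intervalIntegral.integral_add ((hs.add' hqf).intervalIntegrable_sub h0x hx')
      (hκq.intervalIntegrable_sub h0x hx'),
      intervalIntegral.integral_add (hs.intervalIntegrable_sub h0x hx')
      (hqf.intervalIntegrable_sub h0x hx')]
  have h2 := l2Norm_add_le (hs.isL2_primitive.add hqf.isL2_primitive) hκq.isL2_primitive
  have h3 := l2Norm_add_le hs.isL2_primitive hqf.isL2_primitive
  have h4 := l2Norm_integral_mul_le hf hq.hasDerivAt hq.continuous_deriv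
    (fun x _ => hq.abs_le x) hq.abs_deriv_le
  have h5 : l2Norm (fun x => ∫ y in (0 : ℝ)..x, κ * q y) ≤ 3 * (|κ| * (7 / d)) := by
    refine l2Norm_le_of_forall_abs_le (by positivity) fun x hx => ?_
    rw [intervalIntegral.integral_const_mul, abs_mul]
    exact mul_le_mul_of_nonneg_left (hq.abs_integral_le (Ioc_subset_Icc_self hx)) (abs_nonneg κ)
  have h6 : 3 * (|κ| * (7 / d)) ≤ 3 * ((σ + 3 * K * l2Norm F) / d * (7 / d)) := by gcongr
  rw [h1]
  simp only [Pi.add_def] at h2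
  calc _ ≤ σ + (1 / d + 9 * K) * l2Norm F + 3 * ((σ + 3 * K * l2Norm F) / d * (7 / d)) := by
        linarith
    _ = _ := by field_simp; ring

/-- A Poincaré argument: `a ∫ q = ∫ e q - ∫ E q`, and `∫ q` is bounded below by `d`. -/
theorem Weight.l2Norm_le_of_integral_mul_le (hq : Weight q q' d K) {e E : ℝ → ℝ} {a m : ℝ}
    (hE : IsL2 E) (he : ∀ᵐ x ∂(volume.restrict (Ioc 0 (2 * π))), e x = a + E x)
    (hm : |∫ x in (0 : ℝ)..(2 * π), e x * q x| ≤ m) :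
    l2Norm e ≤ 3 / d * m + (1 + 9 / d ^ 2) * l2Norm E := by
  have hd := hq.d_pos
  have h1 : ∫ x in (0 : ℝ)..(2 * π), e x * q x
      = a * (∫ x in (0 : ℝ)..(2 * π), q x) + ∫ x in (0 : ℝ)..(2 * π), E x * q x := by
    rw [← intervalIntegral.integral_const_mul, ← intervalIntegral.integral_add
      (hq.isL2.const_mul' a).intervalIntegrable (hE.mul_intervalIntegrable hq.isL2)]
    apply integral_congr_ae_period
    filter_upwards [he] with x hx
    rw [hx, add_mul]
  have h2 := abs_integral_mul_le hE hq.isL2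
  have h3 : l2Norm q ≤ 3 * (1 / d) := l2Norm_le_of_forall_abs_le (one_div_pos.2 hd).le
    fun x _ => hq.abs_le x
  have h4 : d ≤ ∫ x in (0 : ℝ)..(2 * π), q x := by
    have := hq.le_integral
    nlinarith [one_le_two_pi]
  have h5 : |a| * d ≤ m + 3 / d * l2Norm E := by
    have h6 : |a * ∫ x in (0 : ℝ)..(2 * π), q x| ≤ m + l2Norm E * l2Norm q := by
      have h7 : a * (∫ x in (0 : ℝ)..(2 * π), q x) = (∫ x in (0 : ℝ)..(2 * π), e x * q x)
          - ∫ x in (0 : ℝ)..(2 * π), E x * q x := by linarith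
      rw [h7]
      exact (abs_sub _ _).trans (add_le_add hm h2)
    rw [abs_mul, abs_of_pos (hd.trans_le h4)] at h6
    calc _ ≤ _ := mul_le_mul_of_nonneg_left h4 (abs_nonneg a)
      _ ≤ _ := h6
      _ ≤ m + l2Norm E * (3 * (1 / d)) := by have := l2Norm_nonneg E; gcongr
      _ = _ := by ring
  have h8 : |a| ≤ (m + 3 / d * l2Norm E) / d := (le_div_iff₀ hd).2 h5
  have h9 : l2Norm e = l2Norm fun x => a + E x := l2Norm_congr_ae he
  have h10 := l2Norm_add_le (isL2_const a) hE
  have h11 := l2Norm_const_le a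
  rw [h9]
  calc _ ≤ 3 * ((m + 3 / d * l2Norm E) / d) + l2Norm E := by linarith
    _ = _ := by field_simp; ring

end Primitive

/-! ### Error estimates for one weight -/

namespace RitzData

variable {M : Mesh} {q q' z r g ρ : ℝ → ℝ} {d K c : ℝ} {k : Fin M.N → ℝ}

/-- Quasi-optimality in the energy norm. -/
theorem l2Norm_le_of_isStep (h : RitzData M q z r g ρ k c) (hq : Weight q q' d K) {ψ : ℝ → ℝ}
    {l : Fin M.N → ℝ} (hψ : M.IsStep ψ l) (hψ0 : ∫ x in (0 : ℝ)..(2 * π), ψ x = 0) :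
    l2Norm (fun x => g x - ρ x) ≤ 1 / d ^ 2 * l2Norm fun x => g x - ψ x := by
  set ε : ℝ → ℝ := fun x => g x - ρ x with hε
  have hεL : IsL2 ε := h.isL2_sub
  have hgψ : IsL2 fun x => g x - ψ x := h.deriv_z.2.1.isL2.sub hψ.isL2
  have hd := hq.d_pos
  have h1 := hq.mul_sq_le hεL
  have h2 := h.orthogonal hq (hψ.sub h.step) (by
    simp only [Pi.sub_apply]
    rw [intervalIntegral.integral_sub hψ.isL2.intervalIntegrable h.step.isL2.intervalIntegrable,
      hψ0, h.deriv_r.integral_eq_zero, sub_zero])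
  have h3 : ∫ x in (0 : ℝ)..(2 * π), ε x * (ε x / q x)
      = ∫ x in (0 : ℝ)..(2 * π), (g x - ψ x) * (ε x / q x) := by
    refine Eq.trans ?_ ((congrArg (_ + ·) h2).trans (add_zero _))
    rw [← intervalIntegral.integral_add (hgψ.mul_intervalIntegrable (hq.isL2_div hεL))
      ((hψ.sub h.step).isL2.mul_intervalIntegrable (hq.isL2_div h.isL2_sub))]
    congr 1; ext x
    simp only [hε, Pi.sub_apply]
    ring
  have h4 := (abs_le.1 (abs_integral_mul_le hgψ (hq.isL2_div hεL))).2
  have h5 := hq.l2Norm_div_le hεL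
  rw [h3] at h1
  have h6 : d * l2Norm ε ^ 2 ≤ l2Norm (fun x => g x - ψ x) * (1 / d * l2Norm ε) :=
    (h1.trans h4).trans (mul_le_mul_of_nonneg_left h5 (l2Norm_nonneg _))
  rcases eq_or_lt_of_le (l2Norm_nonneg ε) with h7 | h7
  · rw [← h7]
    have := l2Norm_nonneg fun x => g x - ψ x
    positivity
  · have h8 : l2Norm ε * (d ^ 2 * l2Norm ε) ≤ l2Norm ε * l2Norm fun x => g x - ψ x := by
      calc _ = d * (d * l2Norm ε ^ 2) := by ring
        _ ≤ d * (l2Norm (fun x => g x - ψ x) * (1 / d * l2Norm ε)) := by gcongr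
        _ = _ := by field_simp
    have h9 := le_of_mul_le_mul_left h8 h7
    rw [one_div, ← div_eq_inv_mul, le_div_iff₀ (by positivity)]
    linarith

theorem l2Norm_le (h : RitzData M q z r g ρ k c) (hq : Weight q q' d K) :
    l2Norm (fun x => g x - ρ x) ≤ 1 / d ^ 2 * l2Norm g := by
  have h0 : M.IsStep (fun _ => 0) (fun _ => 0) :=
    ⟨⟨fun _ => rfl, isL2_const 0⟩, fun _ _ _ => rfl⟩
  simpa using h.l2Norm_le_of_isStep hq h0 (by simp)

theorem l2Norm_le_size_mul (h : RitzData M q z r g ρ k c) (hq : Weight q q' d K) {g' : ℝ → ℝ}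
    (hg : IsWeakDeriv g g') :
    l2Norm (fun x => g x - ρ x) ≤ 1 / d ^ 2 * (M.size * l2Norm g') := by
  obtain ⟨ψ, l, hψ, h0, hle⟩ := exists_isStep_l2Norm_sub_le M hg
  refine (h.l2Norm_le_of_isStep hq hψ (h0.trans h.deriv_z.integral_eq_zero)).trans ?_
  exact mul_le_mul_of_nonneg_left hle (by have := hq.d_pos; positivity)

theorem isL2_flux (h : RitzData M q z r g ρ k c) (hq : Weight q q' d K) :
    IsL2 fun x => (g x - ρ x) / q x - c :=
  (hq.isL2_div h.isL2_sub).sub (isL2_const c)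

theorem flux_segment (h : RitzData M q z r g ρ k c) (hq : Weight q q' d K) (j : Fin M.N) :
    ∫ x in (M.node j.castSucc)..(M.node j.succ), ((g x - ρ x) / q x - c) = 0 := by
  rw [intervalIntegral.integral_sub
    (M.intervalIntegrable_segment (hq.isL2_div h.isL2_sub).intervalIntegrable j) (by simp),
    h.flux j, intervalIntegral.integral_const, smul_eq_mul, Mesh.len]
  ring

theorem integral_flux (h : RitzData M q z r g ρ k c) (hq : Weight q q' d K) :
    ∫ x in (0 : ℝ)..(2 * π), ((g x - ρ x) / q x - c) = 0 := by
  rw [← M.sum_integral (h.isL2_flux hq).intervalIntegrable]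
  exact Finset.sum_eq_zero fun j _ => h.flux_segment hq j

/-- The centred flux has zero integral on every segment, so its primitive vanishes at the nodes;
this is the source of the factor `h`. -/
theorem l2Norm_flux_primitive_le (h : RitzData M q z r g ρ k c) (hq : Weight q q' d K) :
    l2Norm (fun x => ∫ y in (0 : ℝ)..x, ((g y - ρ y) / q y - c))
      ≤ 4 / d * (M.size * l2Norm fun x => g x - ρ x) := by
  have h1 := l2Norm_primitive_le M (h.isL2_flux hq) (h.flux_segment hq)
  have h2 := l2Norm_sub_const_le_of_integral_eq_zero (hq.isL2_div h.isL2_sub) (h.integral_flux hq)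
  have h3 := hq.l2Norm_div_le h.isL2_sub
  calc _ ≤ _ := h1
    _ ≤ M.size * (4 * (1 / d * l2Norm fun x => g x - ρ x)) := by
      refine mul_le_mul_of_nonneg_left ?_ M.size_nonneg
      linarith
    _ = _ := by ring

/-- The leading `0` matches the form required by `Weight.l2Norm_primitive_le` with `s = 0` and `κ =
c`. -/
theorem eq_flux (hq : Weight q q' d K) (x : ℝ) :
    0 + q x * ((g x - ρ x) / q x - c) + c * q x = g x - ρ x := by
  have := (hq.pos x).ne'
  field_simp
  ring

theorem integral_sub_eq_zero (h : RitzData M q z r g ρ k c) :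
    ∫ x in (0 : ℝ)..(2 * π), (g x - ρ x) = 0 := by
  rw [intervalIntegral.integral_sub h.deriv_z.2.1.isL2.intervalIntegrable
    h.step.isL2.intervalIntegrable, h.deriv_z.integral_eq_zero, h.deriv_r.integral_eq_zero,
    sub_zero]

theorem abs_coeff_le (h : RitzData M q z r g ρ k c) (hq : Weight q q' d K) :
    |c| ≤ (3 * K * l2Norm (fun x => ∫ y in (0 : ℝ)..x, ((g y - ρ y) / q y - c))) / d := by
  have := hq.abs_coeff_le (isL2_const 0) (h.isL2_flux hq) (h.integral_flux hq) (κ := c) (σ := 0)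
    (by simp only [eq_flux hq]; exact h.integral_sub_eq_zero) (by simp)
  rwa [zero_add] at this

/-- The `L²` error is of one order higher than the `H¹` error. -/
theorem l2Norm_error_le (h : RitzData M q z r g ρ k c) (hq : Weight q q' d K) :
    l2Norm (z - r) ≤ (1 + 9 / d ^ 2) * ((1 / d + 9 * K + 63 * K / d ^ 2) * (4 / d)) *
      (M.size * l2Norm fun x => g x - ρ x) := by
  have hd := hq.d_pos
  have hK := hq.nonneg_bound
  obtain ⟨a, ha⟩ := (h.deriv_z.sub h.deriv_r).exists_primitive
  simp only [Pi.sub_apply] at ha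
  -- The weighted mean of `z - r` vanishes, whence `m = 0`.
  have h1 := hq.l2Norm_le_of_integral_mul_le (m := 0) h.isL2_sub.isL2_primitive (e := z - r) ha (by
    simp only [Pi.sub_apply, sub_mul]
    rw [intervalIntegral.integral_sub (h.deriv_z.1.isL2.mul_intervalIntegrable hq.isL2)
      (h.deriv_r.1.isL2.mul_intervalIntegrable hq.isL2), h.mean, sub_self, abs_zero])
  have h2 := hq.l2Norm_primitive_le (isL2_const 0) (h.isL2_flux hq) (h.integral_flux hq) (κ := c)
    (σ := 0) (by simp only [eq_flux hq]; exact h.integral_sub_eq_zero) (by simp)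
    (by simp [l2Norm])
  simp only [eq_flux hq] at h2
  simp only [mul_zero, zero_add] at h1 h2
  have h3 := h.l2Norm_flux_primitive_le hq
  calc _ ≤ _ := h1
    _ ≤ (1 + 9 / d ^ 2) * ((1 / d + 9 * K + 63 * K / d ^ 2) *
        (4 / d * (M.size * l2Norm fun x => g x - ρ x))) := by
      refine mul_le_mul_of_nonneg_left (h2.trans ?_) (by positivity)
      exact mul_le_mul_of_nonneg_left h3 (by positivity)
    _ = _ := by ring

end RitzData

/-! ### Comparison of two weights -/

section TwoWeights

variable {M : Mesh} {q q' p p' z r s g ρ σ : ℝ → ℝ} {d K c b δ : ℝ} {k l : Fin M.N → ℝ}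

theorem l2Norm_mul_inv_sub_inv_le (hq : Weight q q' d K) (hp : Weight p p' d K)
    (hδ : ∀ x ∈ Icc 0 (2 * π), |q x - p x| ≤ δ) {f : ℝ → ℝ} (hf : IsL2 f) :
    l2Norm (fun x => f x / q x - f x / p x) ≤ δ / d ^ 2 * l2Norm f := by
  have hd := hq.d_pos
  have hδ0 : 0 ≤ δ := (abs_nonneg _).trans (hδ 0 (left_mem_Icc.2 two_pi_pos.le))
  refine l2Norm_le_mul (by positivity) hf ?_
  filter_upwards [ae_restrict_mem measurableSet_Ioc] with x hx
  have hqx := hq.pos x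
  have hpx := hp.pos x
  have h1 : f x / q x - f x / p x = f x * ((p x - q x) * ((q x)⁻¹ * (p x)⁻¹)) := by
    field_simp
  rw [h1, abs_mul, abs_mul, abs_sub_comm, abs_of_pos (mul_pos (inv_pos.2 hqx) (inv_pos.2 hpx)),
    mul_comm |f x|]
  refine mul_le_mul_of_nonneg_right ?_ (abs_nonneg _)
  calc _ ≤ δ * (1 / d * (1 / d)) :=
        mul_le_mul (hδ x (Ioc_subset_Icc_self hx))
          (mul_le_mul (hq.inv_le x) (hp.inv_le x) (inv_pos.2 hpx).le (one_div_pos.2 hd).le)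
          (by positivity) hδ0
    _ = _ := by ring

/-- The projections of the same function for two nearby weights have nearby derivatives. -/
theorem RitzData.l2Norm_deriv_sub_le (h : RitzData M q z r g ρ k c) (hq : Weight q q' d K)
    (h' : RitzData M p z s g σ l b) (hp : Weight p p' d K)
    (hδ : ∀ x ∈ Icc 0 (2 * π), |q x - p x| ≤ δ) :
    l2Norm (fun x => ρ x - σ x) ≤ δ / d ^ 3 * l2Norm fun x => g x - σ x := by
  have hd := hq.d_pos
  have hδ0 : 0 ≤ δ := (abs_nonneg _).trans (hδ 0 (left_mem_Icc.2 two_pi_pos.le))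
  set η : ℝ → ℝ := fun x => ρ x - σ x with hη
  set ε : ℝ → ℝ := fun x => g x - σ x with hε
  have hηs : M.IsStep η (k - l) := h.step.sub h'.step
  have hη0 : ∫ x in (0 : ℝ)..(2 * π), η x = 0 := (h.deriv_r.sub h'.deriv_r).integral_eq_zero
  have hεL : IsL2 ε := h'.isL2_sub
  have h1 := hq.mul_sq_le hηs.isL2
  have h2 := h.orthogonal hq hηs hη0
  have h3 := h'.orthogonal hp hηs hη0
  have hdiff : IsL2 fun x => ε x / q x - ε x / p x := (hq.isL2_div hεL).sub (hp.isL2_div hεL)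
  -- The step function `η` is admissible for both projections, so the last two integrals vanish and
  -- only the difference of the inverse weights remains.
  have h4 : ∫ x in (0 : ℝ)..(2 * π), η x * (η x / q x)
      = (∫ x in (0 : ℝ)..(2 * π), η x * (ε x / q x - ε x / p x))
        - (∫ x in (0 : ℝ)..(2 * π), η x * ((g x - ρ x) / q x))
        + ∫ x in (0 : ℝ)..(2 * π), η x * ((g x - σ x) / p x) := by
    have i1 := hηs.isL2.mul_intervalIntegrable hdiff
    have i2 := hηs.isL2.mul_intervalIntegrable (hq.isL2_div h.isL2_sub)
    have i3 := hηs.isL2.mul_intervalIntegrable (hp.isL2_div h'.isL2_sub)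
    rw [← intervalIntegral.integral_sub i1 i2, ← intervalIntegral.integral_add (i1.sub i2) i3]
    congr 1; ext x
    simp only [hη, hε]
    ring
  rw [h4, h2, h3, sub_zero, add_zero] at h1
  have h5 := (abs_le.1 (abs_integral_mul_le hηs.isL2 hdiff)).2
  have h6 := l2Norm_mul_inv_sub_inv_le hq hp hδ hεL
  have h7 : d * l2Norm η ^ 2 ≤ l2Norm η * (δ / d ^ 2 * l2Norm ε) :=
    (h1.trans h5).trans (mul_le_mul_of_nonneg_left h6 (l2Norm_nonneg η))
  rcases eq_or_lt_of_le (l2Norm_nonneg η) with h8 | h8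
  · rw [← h8]
    have := l2Norm_nonneg ε
    positivity
  · have h9 : l2Norm η * (d * l2Norm η) ≤ l2Norm η * (δ / d ^ 2 * l2Norm ε) := by linarith
    have h10 := le_of_mul_le_mul_left h9 h8
    calc l2Norm η = d * l2Norm η / d := by field_simp
      _ ≤ δ / d ^ 2 * l2Norm ε / d := by gcongr
      _ = _ := by field_simp

/-- The difference of the flux primitives for two nearby weights. -/
theorem RitzData.l2Norm_flux_sub_primitive_le (h : RitzData M q z r g ρ k c)
    (hq : Weight q q' d K) (h' : RitzData M p z s g σ l b) (hp : Weight p p' d K)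
    (hδ : ∀ x ∈ Icc 0 (2 * π), |q x - p x| ≤ δ) :
    l2Norm (fun x => ∫ y in (0 : ℝ)..x,
        (((g y - σ y) / p y - b) - ((g y - ρ y) / q y - c)))
      ≤ 4 * (1 / d ^ 4 + 1 / d ^ 2) * δ * (M.size * l2Norm fun x => g x - σ x) := by
  have hd := hq.d_pos
  set ε : ℝ → ℝ := fun x => g x - σ x with hε
  -- This is the difference of the uncentred fluxes, written so that both parts are visibly of order
  -- `δ`.
  set Y : ℝ → ℝ := fun x => (ρ x - σ x) / q x - (ε x / q x - ε x / p x) with hY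
  have hεL : IsL2 ε := h'.isL2_sub
  have hηL : IsL2 fun x => ρ x - σ x := h.step.isL2.sub h'.step.isL2
  have hdiff : IsL2 fun x => ε x / q x - ε x / p x := (hq.isL2_div hεL).sub (hp.isL2_div hεL)
  have hYL : IsL2 Y := (hq.isL2_div hηL).sub hdiff
  have heq : (fun y => ((g y - σ y) / p y - b) - ((g y - ρ y) / q y - c))
      = fun y => Y y - (b - c) := by
    ext y
    simp only [hY, hε]
    ring
  have hseg : ∀ j : Fin M.N, ∫ x in (M.node j.castSucc)..(M.node j.succ), (Y x - (b - c)) = 0 := by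
    intro j
    rw [← heq, intervalIntegral.integral_sub
      (M.intervalIntegrable_segment (h'.isL2_flux hp).intervalIntegrable j)
      (M.intervalIntegrable_segment (h.isL2_flux hq).intervalIntegrable j),
      h'.flux_segment hp, h.flux_segment hq, sub_zero]
  have hYc : IsL2 fun x => Y x - (b - c) := hYL.sub (isL2_const _)
  have h0 : ∫ x in (0 : ℝ)..(2 * π), (Y x - (b - c)) = 0 := by
    rw [← M.sum_integral hYc.intervalIntegrable]
    exact Finset.sum_eq_zero fun j _ => hseg j
  rw [heq]
  have h1 := l2Norm_primitive_le M hYc hseg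
  have h2 := l2Norm_sub_const_le_of_integral_eq_zero hYL h0
  have h3 := l2Norm_sub_le (hq.isL2_div hηL) hdiff
  have h4 := hq.l2Norm_div_le hηL
  have h5 := l2Norm_mul_inv_sub_inv_le hq hp hδ hεL
  have h6 := h.l2Norm_deriv_sub_le hq h' hp hδ
  have h7 : l2Norm Y ≤ 1 / d * (δ / d ^ 3 * l2Norm ε) + δ / d ^ 2 * l2Norm ε := by
    have : 1 / d * l2Norm (fun x => ρ x - σ x) ≤ 1 / d * (δ / d ^ 3 * l2Norm ε) := by gcongr
    linarith
  calc _ ≤ _ := h1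
    _ ≤ M.size * (4 * (1 / d * (δ / d ^ 3 * l2Norm ε) + δ / d ^ 2 * l2Norm ε)) := by
      refine mul_le_mul_of_nonneg_left ?_ M.size_nonneg
      linarith
    _ = _ := by field_simp

/-- The projections of the same function for two nearby weights are close in `L²`, to one order
higher than in `H¹`. -/
theorem exists_l2Norm_ritz_sub_le (d K : ℝ) (hd : 0 < d) (hK : 0 ≤ K) :
    ∃ C, 0 ≤ C ∧ ∀ (M : Mesh) (q q' p p' z r s g ρ σ : ℝ → ℝ) (c b δ : ℝ) (k l : Fin M.N → ℝ),
      RitzData M q z r g ρ k c → Weight q q' d K → RitzData M p z s g σ l b → Weight p p' d K →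
      (∀ x ∈ Icc 0 (2 * π), |q x - p x| ≤ δ) → (∀ x ∈ Icc 0 (2 * π), |q' x - p' x| ≤ δ) →
      l2Norm (r - s) ≤ C * δ * (M.size * l2Norm fun x => g x - σ x) := by
  set A : ℝ := 1 / d + 9 * K + 63 * K / d ^ 2 with hA
  have hA0 : 0 ≤ A := by positivity
  refine ⟨3 / d * (3 * ((1 + 9 / d ^ 2) * (A * (4 / d)))) + (1 + 9 / d ^ 2) *
    ((1 + 21 / d ^ 2) * ((10 + 63 * K / d) * (4 / d)) + A * (4 * (1 / d ^ 4 + 1 / d ^ 2))),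
    by positivity, ?_⟩
  intro M q q' p p' z r s g ρ σ c b δ k l h hq h' hp hδ hδ'
  have hδ0 : 0 ≤ δ := (abs_nonneg _).trans (hδ 0 (left_mem_Icc.2 two_pi_pos.le))
  set m : ℝ := M.size * l2Norm fun x => g x - σ x with hm
  have hm0 : 0 ≤ m := mul_nonneg M.size_nonneg (l2Norm_nonneg _)
  set f : ℝ → ℝ := fun x => (g x - σ x) / p x - b with hf
  set D : ℝ → ℝ := fun x => f x - ((g x - ρ x) / q x - c) with hD
  have hfL : IsL2 f := h'.isL2_flux hp
  have hDL : IsL2 D := hfL.sub (h.isL2_flux hq)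
  have hF : l2Norm (fun x => ∫ y in (0 : ℝ)..x, f y) ≤ 4 / d * m := h'.l2Norm_flux_primitive_le hp
  have hDp : l2Norm (fun x => ∫ y in (0 : ℝ)..x, D y) ≤ 4 * (1 / d ^ 4 + 1 / d ^ 2) * δ * m :=
    h.l2Norm_flux_sub_primitive_le hq h' hp hδ
  have hf0 : ∫ x in (0 : ℝ)..(2 * π), f x = 0 := h'.integral_flux hp
  have hD0 : ∫ x in (0 : ℝ)..(2 * π), D x = 0 := by
    simp only [hD]
    rw [intervalIntegral.integral_sub hfL.intervalIntegrable (h.isL2_flux hq).intervalIntegrable,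
      hf0, h.integral_flux hq, sub_zero]
  set nF := l2Norm (fun x => ∫ y in (0 : ℝ)..x, f y) with hnF
  have hnF0 : 0 ≤ nF := l2Norm_nonneg _
  -- The mean flux `b` inherits the order in `h` of the flux primitive, so multiplying it by `p - q`
  -- is harmless.
  have hb : |b| ≤ 3 * K * nF / d := h'.abs_coeff_le hp
  have hw : ∀ x, HasDerivAt (fun x => p x - q x) (p' x - q' x) x := fun x =>
    (hp.hasDerivAt x).sub (hq.hasDerivAt x)
  have hwc' : Continuous fun x => p' x - q' x := hp.continuous_deriv.sub hq.continuous_deriv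
  have hwc : Continuous fun x => p x - q x := hp.continuous.sub hq.continuous
  have hw1 : ∀ x ∈ Icc 0 (2 * π), |p x - q x| ≤ δ := fun x hx => by
    rw [abs_sub_comm]; exact hδ x hx
  have hw2 : ∀ x ∈ Icc 0 (2 * π), |p' x - q' x| ≤ δ := fun x hx => by
    rw [abs_sub_comm]; exact hδ' x hx
  have hwf : IsL2 fun x => (p x - q x) * f x := hfL.mul_continuousOn hwc.continuousOn
  have hwL : IsL2 fun x => p x - q x := isL2_of_continuous hwc
  have hwb : IsL2 fun x => b * (p x - q x) := hwL.const_mul' b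
  set S : ℝ → ℝ := fun x => (p x - q x) * f x + b * (p x - q x) with hS
  have hSL : IsL2 S := hwf.add' hwb
  have hSint : ∀ x ∈ Icc 0 (2 * π), ∫ y in (0 : ℝ)..x, S y
      = (∫ y in (0 : ℝ)..x, (p y - q y) * f y) + b * ∫ y in (0 : ℝ)..x, (p y - q y) := by
    intro x hx
    have h0x := left_mem_Icc.2 two_pi_pos.le
    rw [← intervalIntegral.integral_const_mul]
    exact intervalIntegral.integral_add (hwf.intervalIntegrable_sub h0x hx)
      (hwb.intervalIntegrable_sub h0x hx)
  have hwint : ∀ x ∈ Icc 0 (2 * π), |b * ∫ y in (0 : ℝ)..x, (p y - q y)| ≤ |b| * (7 * δ) := by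
    intro x hx
    rw [abs_mul]
    refine mul_le_mul_of_nonneg_left ?_ (abs_nonneg b)
    have h1 := intervalIntegral.norm_integral_le_of_norm_le_const (a := 0) (b := x)
      (f := fun y => p y - q y) (C := δ) fun y hy => by
        rw [uIoc_of_le hx.1] at hy
        exact hw1 y ⟨hy.1.le, hy.2.trans hx.2⟩
    rw [Real.norm_eq_abs, sub_zero, abs_of_nonneg hx.1] at h1
    nlinarith [hx.2, two_pi_le_seven]
  have hbδ : |b| * (7 * δ) ≤ 3 * K * nF / d * (7 * δ) :=
    mul_le_mul_of_nonneg_right hb (by positivity)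
  -- One bound for both the integral and the primitive of `S`: the primitive needs `10 = 1 + 9` and
  -- `63 = 3 * 3 * 7`, while the integral needs only `3` and `21`.
  set τ : ℝ := δ * (10 + 63 * K / d) * nF with hτ
  have hS1 : |∫ x in (0 : ℝ)..(2 * π), S x| ≤ τ := by
    have hx := right_mem_Icc.2 two_pi_pos.le
    have h1 := abs_integral_mul_le_of_primitive hfL hw hwc' hw1 hw2 hx
    rw [hf0, abs_zero, mul_zero, zero_add] at h1
    rw [hSint _ hx]
    calc _ ≤ _ := abs_add_le _ _
      _ ≤ 3 * δ * nF + 3 * K * nF / d * (7 * δ) := add_le_add h1 ((hwint _ hx).trans hbδ)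
      _ = δ * (3 + 21 * K / d) * nF := by ring
      _ ≤ δ * (10 + 63 * K / d) * nF := by gcongr <;> norm_num
  have hS2 : l2Norm (fun x => ∫ y in (0 : ℝ)..x, S y) ≤ τ := by
    have h1 : l2Norm (fun x => ∫ y in (0 : ℝ)..x, S y) = l2Norm fun x =>
        (∫ y in (0 : ℝ)..x, (p y - q y) * f y) + b * ∫ y in (0 : ℝ)..x, (p y - q y) := by
      apply l2Norm_congr_ae
      filter_upwards [ae_restrict_mem measurableSet_Ioc] with x hx
      exact hSint x (Ioc_subset_Icc_self hx)
    have h2 := l2Norm_add_le hwf.isL2_primitive (hwL.isL2_primitive.const_mul' b)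
    have h3 := l2Norm_integral_mul_le hfL hw hwc' hw1 hw2
    have h4 : l2Norm (fun x => b * ∫ y in (0 : ℝ)..x, (p y - q y)) ≤ 3 * (|b| * (7 * δ)) :=
      l2Norm_le_of_forall_abs_le (by positivity) fun x hx => hwint x (Ioc_subset_Icc_self hx)
    rw [h1]
    calc _ ≤ (δ + 9 * δ) * nF + 3 * (3 * K * nF / d * (7 * δ)) := by linarith
      _ = τ := by rw [hτ]; ring
  -- Subtracting `g - ρ = q (f - D + c)` from `g - σ = p (f + b)` puts the difference in the form of
  -- `Weight.l2Norm_primitive_le`; the primitives of `S` and `D` are both of order `δ h`.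
  have hη : ∀ x, S x + q x * D x + (b - c) * q x = ρ x - σ x := by
    intro x
    have h1 := (hq.pos x).ne'
    have h2 := (hp.pos x).ne'
    simp only [hS, hD, hf]
    field_simp
    ring
  have hprim := hq.l2Norm_primitive_le (κ := b - c) hSL hDL hD0 (by
    simp only [hη]
    exact (h.deriv_r.sub h'.deriv_r).integral_eq_zero) hS1 hS2
  simp only [hη] at hprim
  have hηL : IsL2 fun x => ρ x - σ x := h.step.isL2.sub h'.step.isL2
  have hzs : IsL2 fun x => z x - s x := h'.deriv_z.1.isL2.sub h'.deriv_r.1.isL2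
  obtain ⟨a, ha⟩ := (h.deriv_r.sub h'.deriv_r).exists_primitive
  simp only [Pi.sub_apply] at ha
  have hmean : |∫ x in (0 : ℝ)..(2 * π), (r - s) x * q x| ≤ l2Norm (z - s) * (3 * δ) := by
    -- Both mean conditions enter: `∫ (r - s) q = ∫ (z - s) q`, while `∫ (z - s) p = 0`. The `L²`
    -- error of `s` then supplies the factor `h`.
    have h1 : ∫ x in (0 : ℝ)..(2 * π), (r - s) x * q x
        = -∫ x in (0 : ℝ)..(2 * π), (z x - s x) * (p x - q x) := by
      have i1 := h.deriv_r.1.isL2.mul_intervalIntegrable hq.isL2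
      have i2 := h'.deriv_r.1.isL2.mul_intervalIntegrable hq.isL2
      have i3 := h.deriv_z.1.isL2.mul_intervalIntegrable hq.isL2
      have i4 := h.deriv_z.1.isL2.mul_intervalIntegrable hp.isL2
      have i5 := h'.deriv_r.1.isL2.mul_intervalIntegrable hp.isL2
      simp only [Pi.sub_apply, sub_mul, mul_sub]
      rw [intervalIntegral.integral_sub i1 i2,
        intervalIntegral.integral_sub (i4.sub i5) (i3.sub i2),
        intervalIntegral.integral_sub i4 i5, intervalIntegral.integral_sub i3 i2]
      linarith [h.mean, h'.mean]
    rw [h1, abs_neg]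
    refine (abs_integral_mul_le hzs hwL).trans ?_
    exact mul_le_mul_of_nonneg_left (l2Norm_le_of_forall_abs_le hδ0 fun x hx =>
      hw1 x (Ioc_subset_Icc_self hx)) (l2Norm_nonneg _)
  have hfin := hq.l2Norm_le_of_integral_mul_le hηL.isL2_primitive (e := r - s) ha hmean
  have hzs' := h'.l2Norm_error_le hp
  rw [← hm, ← hA] at hzs'
  rw [← hA] at hprim
  calc _ ≤ _ := hfin
    _ ≤ 3 / d * ((1 + 9 / d ^ 2) * (A * (4 / d)) * m * (3 * δ)) + (1 + 9 / d ^ 2) *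
        ((1 + 21 / d ^ 2) * (δ * (10 + 63 * K / d) * (4 / d * m))
          + A * (4 * (1 / d ^ 4 + 1 / d ^ 2) * δ * m)) := by
      gcongr
      refine hprim.trans ?_
      rw [hτ]
      gcongr
    _ = _ := by ring

end TwoWeights

/-! ### Regularity of the speed in space and time -/

section Regularity

variable {E : Type*} [NormedAddCommGroup E] [NormedSpace ℝ E] {T : ℝ} {F : ℝ → ℝ → E}

theorem uniqueDiffOn_strip (hT : 0 < T) : UniqueDiffOn ℝ (Icc 0 T ×ˢ (univ : Set ℝ)) :=
  (uniqueDiffOn_Icc hT).prod uniqueDiffOn_univ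

/-- The vertical line through `t` stays in the strip even for `t = 0` and `t = T`, so the derivative
within the strip gives a full derivative in `x`. -/
theorem hasDerivAt_of_contDiffOn_strip
    (hF : ContDiffOn ℝ ∞ (fun p : ℝ × ℝ => F p.1 p.2) (Icc 0 T ×ˢ univ)) {t : ℝ}
    (ht : t ∈ Icc 0 T) (x : ℝ) :
    HasDerivAt (F t) (fderivWithin ℝ (fun p : ℝ × ℝ => F p.1 p.2) (Icc 0 T ×ˢ univ) (t, x) (0, 1))
      x := by
  have h1 := (hF.differentiableOn (by simp) (t, x) ⟨ht, mem_univ x⟩).hasFDerivWithinAt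
  have h2 : HasDerivWithinAt (fun y : ℝ => (t, y)) ((0 : ℝ), (1 : ℝ)) univ x :=
    ((hasDerivAt_const x t).prodMk (hasDerivAt_id x)).hasDerivWithinAt
  have h3 := h1.comp_hasDerivWithinAt x h2 fun y _ => ⟨ht, mem_univ y⟩
  rw [hasDerivWithinAt_univ] at h3
  exact h3

theorem contDiffOn_strip_deriv (hT : 0 < T)
    (hF : ContDiffOn ℝ ∞ (fun p : ℝ × ℝ => F p.1 p.2) (Icc 0 T ×ˢ univ)) :
    ContDiffOn ℝ ∞ (fun p : ℝ × ℝ => deriv (F p.1) p.2) (Icc 0 T ×ˢ univ) := by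
  have h1 := (hF.fderivWithin (m := ∞) (uniqueDiffOn_strip hT) (by simp)).clm_apply
    (contDiffOn_const (c := ((0 : ℝ), (1 : ℝ))))
  refine h1.congr fun p hp => ?_
  exact (hasDerivAt_of_contDiffOn_strip hF hp.1 p.2).deriv

/-- A `C¹` function is Lipschitz on the compact convex rectangle `[0, T] × [0, 2π]`. -/
theorem exists_lipschitz_strip
    (hF : ContDiffOn ℝ ∞ (fun p : ℝ × ℝ => F p.1 p.2) (Icc 0 T ×ˢ univ)) :
    ∃ L, 0 ≤ L ∧ ∀ t ∈ Icc 0 T, ∀ τ ∈ Icc 0 T, ∀ x ∈ Icc 0 (2 * π),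
      ‖F t x - F τ x‖ ≤ L * |t - τ| := by
  have h1 : ContDiffOn ℝ 1 (fun p : ℝ × ℝ => F p.1 p.2) (Icc 0 T ×ˢ Icc 0 (2 * π)) :=
    (hF.of_le (by simp)).mono (prod_mono_right (subset_univ _))
  obtain ⟨L, hL⟩ := h1.exists_lipschitzOnWith (by simp)
    ((convex_Icc _ _).prod (convex_Icc _ _)) (isCompact_Icc.prod isCompact_Icc)
  refine ⟨L, L.2, fun t ht τ hτ x hx => ?_⟩
  have h2 := hL.dist_le_mul (t, x) ⟨ht, hx⟩ (τ, x) ⟨hτ, hx⟩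
  rw [dist_eq_norm, Prod.dist_eq, dist_self, max_eq_left dist_nonneg, Real.dist_eq] at h2
  exact h2

end Regularity

section Curve

variable {T d₀ : ℝ} {u : ℝ → ℝ → EuclideanSpace ℝ (Fin 2)}

theorem IsEvolvingCurve.contDiffOn_speed (hu : IsEvolvingCurve T d₀ u) (hT : 0 < T) :
    ContDiffOn ℝ ∞ (fun p : ℝ × ℝ => speed u p.1 p.2) (Icc 0 T ×ˢ univ) :=
  (contDiffOn_strip_deriv hT hu.smooth).norm ℝ fun p hp =>
    norm_pos_iff.1 (hu.d₀_pos.trans_le (hu.le_speed p.1 hp.1 p.2))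

theorem IsEvolvingCurve.exists_weight (hu : IsEvolvingCurve T d₀ u) (hT : 0 < T) :
    ∃ K, 0 ≤ K ∧ ∀ t ∈ Icc 0 T, Weight (speed u t) (deriv (speed u t)) d₀ K := by
  have hs := hu.contDiffOn_speed hT
  have hs' := contDiffOn_strip_deriv hT hs
  obtain ⟨K, hK⟩ := (isCompact_Icc.prod isCompact_Icc).exists_bound_of_continuousOn
    (s := Icc 0 T ×ˢ Icc 0 (2 * π)) (hs'.continuousOn.mono (prod_mono_right (subset_univ _)))
  have hb : ∀ t ∈ Icc 0 T, ∀ x ∈ Icc 0 (2 * π), |deriv (speed u t) x| ≤ K := fun t ht x hx =>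
    hK (t, x) ⟨ht, hx⟩
  refine ⟨K, (abs_nonneg _).trans (hb 0 (left_mem_Icc.2 hT.le) 0 (left_mem_Icc.2 two_pi_pos.le)),
    fun t ht => ⟨hu.d₀_pos, fun x => ?_, ?_, hu.le_speed t ht, hu.speed_le t ht, hb t ht⟩⟩
  · exact (hasDerivAt_of_contDiffOn_strip hs ht x).differentiableAt.hasDerivAt
  · have hc : Continuous fun x : ℝ => (t, x) := by fun_prop
    exact ContinuousOn.comp_continuous (g := fun p : ℝ × ℝ => deriv (speed u p.1) p.2)
      (f := fun x => (t, x)) hs'.continuousOn hc fun x => ⟨ht, mem_univ x⟩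

/-- The case distinction ensures that the constant is exactly `0` for a stationary curve; otherwise
compactness provides one. -/
theorem IsEvolvingCurve.exists_speed_lipschitz (hu : IsEvolvingCurve T d₀ u) (hT : 0 < T) :
    ∃ L, 0 ≤ L ∧
      ((∀ t ∈ Icc 0 T, ∀ τ ∈ Icc 0 T, ∀ x, deriv (u t) x = deriv (u τ) x) → L = 0) ∧
      ∀ t ∈ Icc 0 T, ∀ τ ∈ Icc 0 T, ∀ x ∈ Icc 0 (2 * π),
        |speed u t x - speed u τ x| ≤ L * |t - τ| ∧
        |deriv (speed u t) x - deriv (speed u τ) x| ≤ L * |t - τ| := by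
  by_cases hst : ∀ t ∈ Icc 0 T, ∀ τ ∈ Icc 0 T, ∀ x, deriv (u t) x = deriv (u τ) x
  · refine ⟨0, le_rfl, fun _ => rfl, fun t ht τ hτ x _ => ?_⟩
    have : speed u t = speed u τ := funext fun y => by
      unfold speed
      rw [hst t ht τ hτ y]
    simp [this]
  · have hs := hu.contDiffOn_speed hT
    obtain ⟨L₁, hL₁, h₁⟩ := exists_lipschitz_strip hs
    obtain ⟨L₂, hL₂, h₂⟩ := exists_lipschitz_strip (F := fun t => deriv (speed u t))
      (contDiffOn_strip_deriv hT hs)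
    refine ⟨max L₁ L₂, le_max_of_le_left hL₁, fun h => absurd h hst, fun t ht τ hτ x hx => ?_⟩
    exact ⟨(h₁ t ht τ hτ x hx).trans
        (mul_le_mul_of_nonneg_right (le_max_left _ _) (abs_nonneg _)),
      (h₂ t ht τ hτ x hx).trans
        (mul_le_mul_of_nonneg_right (le_max_right _ _) (abs_nonneg _))⟩

end Curve

/-- The energy error for a function in `W^{s,2}`. -/
theorem RitzData.l2Norm_le_sobolevNorm {M : Mesh} {q q' z r g ρ : ℝ → ℝ} {d K c : ℝ}
    {k : Fin M.N → ℝ} (h : RitzData M q z r g ρ k c) (hq : Weight q q' d K) {s : ℕ}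
    (hs : s = 1 ∨ s = 2) (hz : MemSobolev s z) :
    l2Norm (fun x => g x - ρ x) ≤ 1 / d ^ 2 * (M.size ^ (s - 1) * sobolevNorm s z) := by
  have hd : 0 ≤ 1 / d ^ 2 := by have := hq.d_pos; positivity
  rcases hs with rfl | rfl
  · refine (h.l2Norm_le hq).trans (mul_le_mul_of_nonneg_left ?_ hd)
    rw [← h.deriv_z.l2Norm_weakDeriv, Nat.sub_self, pow_zero, one_mul]
    exact l2Norm_iterate_le_sobolevNorm (k := 1) le_rfl z
  · have h1 := hz.isWeakDeriv_weakDeriv_weakDeriv.congr_left h.deriv_z.2.1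
      h.deriv_z.weakDeriv_ae.symm
    refine (h.l2Norm_le_size_mul hq h1).trans (mul_le_mul_of_nonneg_left ?_ hd)
    rw [show 2 - 1 = 1 from rfl, pow_one]
    exact mul_le_mul_of_nonneg_left (l2Norm_iterate_le_sobolevNorm (k := 2) le_rfl z)
      M.size_nonneg

end CurveFEM

/-! ### Assembly of the four estimates -/

open CurveFEM
theorem mainTheorem3 (T d₀ : ℝ) (hT : 0 < T) (u : ℝ → ℝ → EuclideanSpace ℝ (Fin 2))
    (hu : IsEvolvingCurve T d₀ u) (Cbar : ℝ) (hCbar : 0 < Cbar) :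
    ∃ C Cg : ℝ, 0 ≤ C ∧ 0 ≤ Cg ∧
      ((∀ t ∈ Icc 0 T, ∀ τ ∈ Icc 0 T, ∀ x, deriv (u t) x = deriv (u τ) x) → Cg = 0) ∧
      ∀ M : Mesh, M.QuasiUniform Cbar →
        (∀ t ∈ Icc 0 T, ∀ z : ℝ → ℝ, MemSobolev 1 z → ∃! r, IsRitz u M t z r) ∧
        ∀ s : ℕ, s = 1 ∨ s = 2 →
          ∀ z : ℝ → ℝ → ℝ, (∀ t ∈ Icc 0 T, MemSobolev s (z t)) →
            ∀ t ∈ Icc 0 T, ∀ τ ∈ Icc 0 T,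
              l2Norm (weakDeriv (ritz u M t (z t) - ritz u M τ (z τ))) ≤
                  Cg * |t - τ| * M.size ^ (s - 1) * sobolevNorm s (z τ) +
                    C * l2Norm (weakDeriv (z t - z τ)) ∧
              l2Norm (ritz u M t (z t) - ritz u M τ (z τ)) ≤
                  Cg * |t - τ| * sobolevNorm 1 (z τ) + C * sobolevNorm 1 (z t - z τ) ∧
              l2Norm (weakDeriv (ritz u M t (z t) - ritz u M τ (z τ) - (z t - z τ))) ≤
                  C * M.size ^ (s - 1) * sobolevNorm s (z t - z τ) +
                    Cg * |t - τ| * M.size ^ (s - 1) * sobolevNorm s (z τ) ∧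
              l2Norm (ritz u M t (z t) - ritz u M τ (z τ) - (z t - z τ)) ≤
                  Cg * |t - τ| * M.size ^ s * sobolevNorm s (z τ) +
                    C * M.size ^ s * sobolevNorm s (z t - z τ) := by
  obtain ⟨K, hK, hW⟩ := hu.exists_weight hT
  obtain ⟨L, hL, hL0, hLip⟩ := hu.exists_speed_lipschitz hT
  have hd := hu.d₀_pos
  obtain ⟨C₃, hC₃, hdiff⟩ := exists_l2Norm_ritz_sub_le d₀ K hd hK
  obtain ⟨C₁, hC₁⟩ : ∃ C, C = (1 + 9 / d₀ ^ 2) *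
    ((1 / d₀ + 9 * K + 63 * K / d₀ ^ 2) * (4 / d₀)) := ⟨_, rfl⟩
  have hC₁0 : 0 ≤ C₁ := by rw [hC₁]; positivity
  -- In each constant the power `1 / d₀ ^ 2` is quasi-optimality, `1 / d₀ ^ 5` combines it with the
  -- `1 / d₀ ^ 3` of the weight comparison, and `7` bounds the mesh size. The factor `L` makes the
  -- second constant vanish for a stationary curve.
  refine ⟨1 + 1 / d₀ ^ 2 + 7 * C₁ / d₀ ^ 2, L * (1 / d₀ ^ 5 + 7 * C₃ / d₀ ^ 2), by positivity,
    by positivity, fun h => by rw [hL0 h, zero_mul], fun M _ => ⟨fun t ht z hz =>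
      existsUnique_isRitz (hW t ht) hz.isWeakDeriv_weakDeriv, fun s hs z hz t ht τ hτ => ?_⟩⟩
  have hs1 : ∀ y ∈ Icc 0 T, MemSobolev 1 (z y) := fun y hy => by
    have h1 := hz y hy
    rcases hs with rfl | rfl
    · exact h1
    · exact memSobolev_one_iff.2 ⟨_, h1.isWeakDeriv_weakDeriv⟩
  have hqt := hW t ht
  have hqτ := hW τ hτ
  obtain ⟨ρt, kt, ct, ht'⟩ := ritzData_ritz M hqt (hs1 t ht).isWeakDeriv_weakDeriv
  obtain ⟨ρx, kx, cx, hx'⟩ := ritzData_ritz M hqt (hs1 τ hτ).isWeakDeriv_weakDeriv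
  obtain ⟨ρτ, kτ, cτ, hτ'⟩ := ritzData_ritz M hqτ (hs1 τ hτ).isWeakDeriv_weakDeriv
  -- The intermediate projection of `z τ` at time `t` splits the difference into a fixed-weight
  -- part, described by `hw'`, and a comparison of weights for `z τ`.
  have hw' := ht'.sub hqt hx'
  set w := z t - z τ with hw
  set gw := weakDeriv (z t) - weakDeriv (z τ) with hgw
  set rt := ritz u M t (z t)
  set rx := ritz u M t (z τ)
  set rτ := ritz u M τ (z τ)
  set gτ := weakDeriv (z τ)
  set δ : ℝ := L * |t - τ| with hδ
  have hδ0 : 0 ≤ δ := by positivity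
  have hh := M.size_nonneg
  have hh7 : M.size ≤ 7 := M.size_le.trans two_pi_le_seven
  have hpow : M.size * M.size ^ (s - 1) = M.size ^ s := by
    rcases hs with rfl | rfl
    · simp
    · simp [sq]
  have hgwL : IsL2 gw := hw'.deriv_z.2.1.isL2
  have hEL : IsL2 fun x => gw x - (ρt - ρx) x := hw'.isL2_sub
  have hwn : l2Norm (weakDeriv w) = l2Norm gw := hw'.deriv_z.l2Norm_weakDeriv
  have e1 := hw'.l2Norm_le_sobolevNorm hqt hs ((hz t ht).sub (hz τ hτ))
  have e1' := hw'.l2Norm_le_sobolevNorm hqt (Or.inl rfl) ((hs1 t ht).sub (hs1 τ hτ))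
  have e1'' := hw'.l2Norm_le hqt
  have e2 := hτ'.l2Norm_le_sobolevNorm hqτ hs (hz τ hτ)
  have e2' := hτ'.l2Norm_le_sobolevNorm hqτ (Or.inl rfl) (hs1 τ hτ)
  have e3 : l2Norm (w - (rt - rx)) ≤ C₁ * (M.size * l2Norm fun x => gw x - (ρt - ρx) x) := by
    rw [hC₁]
    exact hw'.l2Norm_error_le hqt
  have e4 : l2Norm (fun x => ρx x - ρτ x) ≤ δ / d₀ ^ 3 * l2Norm fun x => gτ x - ρτ x :=
    hx'.l2Norm_deriv_sub_le hqt hτ' hqτ fun x hx => (hLip t ht τ hτ x hx).1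
  have e5 : l2Norm (rx - rτ) ≤ C₃ * δ * (M.size * l2Norm fun x => gτ x - ρτ x) :=
    hdiff M _ _ _ _ _ _ _ _ _ _ _ _ _ _ _ hx' hqt hτ' hqτ
      (fun x hx => (hLip t ht τ hτ x hx).1) fun x hx => (hLip t ht τ hτ x hx).2
  rw [Nat.sub_self, pow_zero, one_mul] at e1' e2'
  set nw := l2Norm fun x => gw x - (ρt - ρx) x
  set nτ := l2Norm fun x => gτ x - ρτ x
  have hnw : 0 ≤ nw := l2Norm_nonneg _
  have hnτ : 0 ≤ nτ := l2Norm_nonneg _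
  set Sw := sobolevNorm s w
  set Sτ := sobolevNorm s (z τ)
  set Vw := sobolevNorm 1 w
  set Vτ := sobolevNorm 1 (z τ)
  set H := M.size ^ (s - 1)
  have hH : 0 ≤ H := pow_nonneg hh _
  have hSw : 0 ≤ Sw := sobolevNorm_nonneg _ _
  have hSτ : 0 ≤ Sτ := sobolevNorm_nonneg _ _
  have hVw : 0 ≤ Vw := sobolevNorm_nonneg _ _
  have hVτ : 0 ≤ Vτ := sobolevNorm_nonneg _ _
  have hρ : IsL2 fun x => ρx x - ρτ x := hx'.step.isL2.sub hτ'.step.isL2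
  have hwL : IsL2 w := hw'.deriv_z.1.isL2
  have hrxτ : IsL2 (rx - rτ) := hx'.deriv_r.1.isL2.sub hτ'.deriv_r.1.isL2
  have hwr : IsL2 (w - (rt - rx)) := hwL.sub hw'.deriv_r.1.isL2
  have hηle : l2Norm (fun x => ρx x - ρτ x) ≤ L * (1 / d₀ ^ 5) * |t - τ| * H * Sτ := by
    calc _ ≤ δ / d₀ ^ 3 * nτ := e4
      _ ≤ δ / d₀ ^ 3 * (1 / d₀ ^ 2 * (H * Sτ)) := by gcongr
      _ = _ := by rw [hδ]; field_simp
  have hηle' : l2Norm (fun x => ρx x - ρτ x)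
      ≤ L * (1 / d₀ ^ 5 + 7 * C₃ / d₀ ^ 2) * |t - τ| * H * Sτ := by
    refine hηle.trans ?_
    gcongr
    exact le_add_of_nonneg_right (by positivity)
  have hdE := ht'.deriv_r.sub hτ'.deriv_r
  refine ⟨?_, ?_, ?_, ?_⟩
  · rw [hdE.l2Norm_weakDeriv, hwn]
    have h1 : ρt - ρτ = fun x => (gw x - (gw x - (ρt - ρx) x)) + (ρx x - ρτ x) := by
      ext x; simp only [Pi.sub_apply]; ring
    have h2 := l2Norm_add_le (hgwL.sub hEL) hρ
    have h3 := l2Norm_sub_le hgwL hEL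
    have hn := l2Norm_nonneg gw
    rw [h1]
    calc _ ≤ _ := h2
      _ ≤ (l2Norm gw + 1 / d₀ ^ 2 * l2Norm gw)
          + L * (1 / d₀ ^ 5 + 7 * C₃ / d₀ ^ 2) * |t - τ| * H * Sτ :=
        add_le_add (h3.trans (add_le_add le_rfl e1'')) hηle'
      _ = L * (1 / d₀ ^ 5 + 7 * C₃ / d₀ ^ 2) * |t - τ| * H * Sτ
          + (1 + 1 / d₀ ^ 2) * l2Norm gw := by ring
      _ ≤ _ := by
        have h4 : 0 ≤ 7 * C₁ / d₀ ^ 2 := by positivity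
        exact add_le_add le_rfl (mul_le_mul_of_nonneg_right (le_add_of_nonneg_right h4) hn)
  · have h1 : rt - rτ = fun x => (w x - (w - (rt - rx)) x) + (rx - rτ) x := by
      ext x; simp only [Pi.sub_apply]; ring
    have h2 := l2Norm_add_le (hwL.sub hwr) hrxτ
    have h3 := l2Norm_sub_le hwL hwr
    have h4 : l2Norm w ≤ Vw := l2Norm_iterate_le_sobolevNorm (k := 0) (Nat.zero_le 1) w
    rw [h1]
    calc _ ≤ _ := h2
      -- No power of `h` is wanted here, so the mesh size is bounded by `7` and the energy errors
      -- are used with `s = 1`.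
      _ ≤ (Vw + C₁ * (7 * (1 / d₀ ^ 2 * Vw))) + C₃ * δ * (7 * (1 / d₀ ^ 2 * Vτ)) := by
        refine add_le_add (h3.trans (add_le_add h4 (e3.trans ?_))) (e5.trans ?_)
        · gcongr
        · gcongr
      _ = L * (7 * C₃ / d₀ ^ 2) * |t - τ| * Vτ + (1 + 7 * C₁ / d₀ ^ 2) * Vw := by
        rw [hδ]; ring
      _ ≤ _ := by
        gcongr
        · exact le_add_of_nonneg_left (by positivity)
        · exact le_add_of_nonneg_right (by positivity)
  · rw [(hdE.sub hw'.deriv_z).l2Norm_weakDeriv]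
    have h1 : ρt - ρτ - gw = fun x => (ρx x - ρτ x) - (gw x - (ρt - ρx) x) := by
      ext x; simp only [Pi.sub_apply]; ring
    have h2 := l2Norm_sub_le hρ hEL
    rw [h1]
    calc _ ≤ _ := h2
      _ ≤ L * (1 / d₀ ^ 5 + 7 * C₃ / d₀ ^ 2) * |t - τ| * H * Sτ + 1 / d₀ ^ 2 * (H * Sw) :=
        add_le_add hηle' e1
      _ = 1 / d₀ ^ 2 * H * Sw + L * (1 / d₀ ^ 5 + 7 * C₃ / d₀ ^ 2) * |t - τ| * H * Sτ := by ring
      _ ≤ _ := by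
        gcongr
        have : 0 ≤ 7 * C₁ / d₀ ^ 2 := by positivity
        linarith
  · have h1 : rt - rτ - w = fun x => (rx - rτ) x - (w - (rt - rx)) x := by
      ext x; simp only [Pi.sub_apply]; ring
    have h2 := l2Norm_sub_le hrxτ hwr
    rw [h1]
    calc _ ≤ _ := h2
      -- The extra factor `M.size` from the `L²` estimates raises `h^(s-1)` to `h^s`.
      _ ≤ C₃ * δ * (M.size * (1 / d₀ ^ 2 * (H * Sτ)))
          + C₁ * (M.size * (1 / d₀ ^ 2 * (H * Sw))) := by
        refine add_le_add (e5.trans ?_) (e3.trans ?_)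
        · gcongr
        · gcongr
      _ = L * (C₃ / d₀ ^ 2) * |t - τ| * (M.size * H) * Sτ
          + C₁ / d₀ ^ 2 * (M.size * H) * Sw := by
        rw [hδ]; ring
      _ ≤ _ := by
        rw [hpow]
        have h5 : C₃ / d₀ ^ 2 ≤ 1 / d₀ ^ 5 + 7 * C₃ / d₀ ^ 2 := by
          have h6 : 0 ≤ 1 / d₀ ^ 5 := by positivity
          have h7 : 0 ≤ C₃ / d₀ ^ 2 := by positivity
          rw [mul_div_assoc]
          linarith
        have h8 : C₁ / d₀ ^ 2 ≤ 1 + 1 / d₀ ^ 2 + 7 * C₁ / d₀ ^ 2 := by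
          have h6 : 0 ≤ 1 / d₀ ^ 2 := by positivity
          have h7 : 0 ≤ C₁ / d₀ ^ 2 := by positivity
          rw [mul_div_assoc]
          linarith
        gcongr
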